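/- Fix $1<p<\infty$ and let $L_p=L_p[0,1]$ be the real $L_p$-space of Lebesgue measure; $[\,\cdot\,]$ denotes the closed linear span. **Notation.** For $n\ge 0$ let $\mathcal D^n$ be the set of dyadic intervals $[\frac{i-1}{2^n},\frac{i}{2^n})$, $1\le i\le 2^n$, and $\mathcal D_n=\bigcup_{k=0}^n\mathcal D^k$. Order dyadic intervals lexicographically: for $I\in\mathcal D^m$, $J\in\mathcal D^n$, $I<J$ iff $m<n$, or $m=n$ and $\min I<\min J$. Let $I^+,I^-$ be the left and right halves of $I$, $h_I=\chi_{I^+}-\chi_{I^-}$, and let $L_p^{n,0}$ be the space of mean-zero functions in the span of $(\chi_I)_{I\in\mathcal D^n}$. For $I=[a,b)\subseteq[0,1)$ let $T_I:L_p\to L_p$ be $(T_If)(t)=f(\frac{t-a}{b-a})$ for $t\in I$ and $(T_If)(t)=0$ otherwise. For every countable limit ordinal $\alpha$ fix linear operators $T^\alpha_\beta:L_p\to L_p$, $0\le\beta<\alpha$, that are distributional embeddings ($T^\alpha_\beta f$ has the same distribution as $f$) with independent ranges (for all $(f_\beta)_{\beta<\alpha}$ in $L_p$ the functions $(T^\alpha_\beta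 f_\beta)_{\beta<\alpha}$ are independent). **Spaces.** Let $R_0^p$ be the constants, $R_{\beta+1}^p=T_{[0,1/2)}(R_\beta^p)+T_{[1/2,1)}(R_\beta^p)$, and $R_\alpha^p=[T_\beta^\alpha(R_\beta^p):\beta<\alpha]$ for limit $\alpha$; put $R_\alpha^{p,0}=\{f\in R_\alpha^p:\mathbb E f=0\}$. **Trees.** Every ordinal is uniquely $\alpha=\beta+\kappa(\alpha)$ with $\beta$ zero or a limit and $\kappa(\alpha)\in\mathbb N\cup\{0\}$. Define sets $\mathcal T_\alpha$ of finite sequences of ordinals and dyadic intervals by $\mathcal T_0=\emptyset$; $\mathcal T_\alpha=\{(\alpha)\}\cup\{(\alpha,I)^\frown\mu: I\in\mathcal D^{\kappa(\alpha)},\,\mu\in\mathcal T_\beta\}$ if $\alpha=\beta+\kappa(\alpha)$ is a successor; $\mathcal T_\alpha=\bigcup_{1\le\beta<\alpha}\{(\alpha)^\frown\mu:\mu\in\mathcal T_\beta\}$ if $\alpha$ is a limit. Order $\mathcal T_\alpha$ by the initial-segment order $\sqsubseteq$, and let $\kappa(\lambda)$ be $\kappa$ of the last entry of $\lambda\in\mathcal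 T_\alpha$. Define $T_\lambda:L_p\to L_p$ by $T_{(\alpha)}=\mathrm{id}$, $T_{(\alpha,I)^\frown\mu}=T_IT_\mu$, and $T_{(\alpha)^\frown\mu}=T^\alpha_\beta T_\mu$ for limit $\alpha$ and $\mu\in\mathcal T_\beta$. Put $h^\lambda_I=T_\lambda h_I$ for $I\in\mathcal D_{\kappa(\lambda)-1}$ and $X_\lambda=T_\lambda(L_p^{\kappa(\lambda),0})$. **Theorem.** Let $\alpha<\omega_1$ and let $(\lambda_n,I_n)_n$ be an enumeration without repetition (a finite sequence if $\alpha$ is finite) of $\{(\lambda,I):\lambda\in\mathcal T_\alpha,\ I\in\mathcal D_{\kappa(\lambda)-1}\}$ such that for all $n<m$ one of the following holds: (a) $\lambda_n$ and $\lambda_m$ are incomparable; (b) $\lambda_n\sqsubsetneq\lambda_m$; (c) $\lambda_n=\lambda_m$ and $I_n<I_m$. Then: 1. $(h^{\lambda_n}_{I_n})_n$ is a martingale difference sequence, i.e. $\mathbb E(h^{\lambda_n}_{I_n}\mid h^{\lambda_1}_{I_1},\dots,h^{\lambda_{n-1}}_{I_{n-1}})=0$ for $n\ge2$, and $[(h^{\lambda_n}_{I_n})_n]=R_\alpha^{p,0}$.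 2. $(h^{\lambda_n}_{I_n})_n$ is an unconditional basis of $R_\alpha^{p,0}$: every $x\in R_\alpha^{p,0}$ has a unique norm-convergent expansion $x=\sum_n a_nh^{\lambda_n}_{I_n}$ with real $a_n$, and there is $C\ge1$ with $\|\sum_{n\le k}a_nh^{\lambda_n}_{I_n}\|\le C\|\sum_{n\le k}b_nh^{\lambda_n}_{I_n}\|$ whenever $|a_n|\le|b_n|$ for $n\le k$. 3. $(X_\lambda)_{\lambda\in\mathcal T_\alpha}$ is an unconditional FDD of $R_\alpha^{p,0}$: for every enumeration $(\nu_n)_n$ of $\mathcal T_\alpha$ without repetition, the $X_{\nu_n}$ are finite-dimensional (closed) subspaces of $R_\alpha^{p,0}$, every $x\in R_\alpha^{p,0}$ is uniquely a norm-convergent sum $x=\sum_nx_n$ with $x_n\in X_{\nu_n}$, and every sequence of nonzero vectors $x_n\in X_{\nu_n}$ is an unconditional basis of its closed linear span. -/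

import Mathlib

open MeasureTheory ProbabilityTheory Filter Topology
open scoped ENNReal Ordinal

noncomputable section

namespace BRS

/-! ### The space `L_p = L_p[0,1]` -/

/-- Lebesgue measure on `[0,1]`. -/
abbrev unitMeasure : Measure ℝ := volume.restrict (Set.Icc (0 : ℝ) 1)

instance isProbabilityMeasure_unitMeasure : IsProbabilityMeasure unitMeasure :=
  ⟨by simp [unitMeasure]⟩

/-- The real Banach space `L_p = L_p[0,1]`. -/
abbrev LpI (p : ℝ≥0∞) : Type := Lp ℝ p unitMeasure

/-- `L_p^0`: the functions of mean zero in `L_p`. -/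
def meanZero (p : ℝ≥0∞) [Fact (1 ≤ p)] : Submodule ℝ (LpI p) where
  carrier := {f | ∫ t, f t ∂unitMeasure = 0}
  add_mem' {f g} hf hg := by
    have hf' := (Lp.memLp f).integrable (Fact.out : 1 ≤ p)
    have hg' := (Lp.memLp g).integrable (Fact.out : 1 ≤ p)
    simp only [Set.mem_ofPred_eq] at hf hg ⊢
    rw [integral_congr_ae (Lp.coeFn_add f g)]
    simp only [Pi.add_apply]
    rw [integral_add hf' hg', hf, hg, add_zero]
  zero_mem' := by
    simp only [Set.mem_ofPred_eq]
    rw [integral_congr_ae (Lp.coeFn_zero ℝ p unitMeasure)]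
    simp
  smul_mem' c f hf := by
    simp only [Set.mem_ofPred_eq] at hf ⊢
    rw [integral_congr_ae (Lp.coeFn_smul c f)]
    simp only [Pi.smul_apply]
    rw [integral_smul, hf, smul_zero]

/-! ### The compressions `T_I` -/

/-- `T_I f` for `I = [a,b)`, as a function: `f((t-a)/(b-a))` on `[a,b)` and `0` elsewhere. -/
def compressFun (a b : ℝ) (f : ℝ → ℝ) : ℝ → ℝ :=
  (Set.Ico a b).indicator fun t => f ((t - a) / (b - a))

theorem measurable_rescale (a b : ℝ) : Measurable fun t : ℝ => (t - a) / (b - a) := by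
  fun_prop

theorem map_rescale_le {a b : ℝ} (hab : a < b) :
    Measure.map (fun t : ℝ => (t - a) / (b - a)) (unitMeasure.restrict (Set.Ico a b)) ≤
      ENNReal.ofReal (b - a) • unitMeasure := by
  have hc : 0 < b - a := sub_pos.2 hab
  have hvol : Measure.map (fun t : ℝ => (t - a) / (b - a)) volume =
      ENNReal.ofReal (b - a) • (volume : Measure ℝ) := by
    have h1 : (fun t : ℝ => (t - a) / (b - a)) =
        (fun t : ℝ => t * (b - a)⁻¹) ∘ fun t : ℝ => t - a := by
      funext t; simp [div_eq_mul_inv]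
    rw [h1, ← Measure.map_map (by fun_prop) (by fun_prop),
      (measurePreserving_sub_right volume a).map_eq,
      Real.map_volume_mul_right (inv_ne_zero hc.ne'), inv_inv, abs_of_pos hc]
  have hpre : (fun t : ℝ => (t - a) / (b - a)) ⁻¹' Set.Ico 0 1 = Set.Ico a b := by
    ext t
    simp only [Set.mem_preimage, Set.mem_Ico, le_div_iff₀ hc, div_lt_iff₀ hc]
    constructor <;> rintro ⟨h, h'⟩ <;> constructor <;> linarith
  calc Measure.map (fun t : ℝ => (t - a) / (b - a)) (unitMeasure.restrict (Set.Ico a b))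
      ≤ Measure.map (fun t : ℝ => (t - a) / (b - a)) (volume.restrict (Set.Ico a b)) :=
        Measure.map_mono (Measure.restrict_mono_measure Measure.restrict_le_self _)
          (measurable_rescale a b)
    _ = (ENNReal.ofReal (b - a) • (volume : Measure ℝ)).restrict (Set.Ico 0 1) := by
        rw [← hvol, Measure.restrict_map (measurable_rescale a b) measurableSet_Ico, hpre]
    _ ≤ ENNReal.ofReal (b - a) • unitMeasure := by
        rw [Measure.restrict_smul]
        gcongr
        exact Measure.restrict_mono Set.Ico_subset_Icc_self le_rfl

theorem quasiMeasurePreserving_rescale {a b : ℝ} (hab : a < b) :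
    Measure.QuasiMeasurePreserving (fun t : ℝ => (t - a) / (b - a))
      (unitMeasure.restrict (Set.Ico a b)) unitMeasure :=
  ⟨measurable_rescale a b,
    (Measure.absolutelyContinuous_of_le (map_rescale_le hab)).trans
      Measure.smul_absolutelyContinuous⟩

theorem memLp_compressFun {p : ℝ≥0∞} {a b : ℝ} (hab : a < b) (f : LpI p) :
    MemLp (compressFun a b f) p unitMeasure := by
  unfold compressFun
  rw [memLp_indicator_iff_restrict measurableSet_Ico]
  have h : MemLp f p (Measure.map (fun t : ℝ => (t - a) / (b - a))
      (unitMeasure.restrict (Set.Ico a b))) :=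
    ((Lp.memLp f).smul_measure ENNReal.ofReal_ne_top).mono_measure (map_rescale_le hab)
  exact h.comp_of_map (measurable_rescale a b).aemeasurable

theorem compressFun_congr {a b : ℝ} (hab : a < b) {f g : ℝ → ℝ} (h : f =ᵐ[unitMeasure] g) :
    compressFun a b f =ᵐ[unitMeasure] compressFun a b g := by
  have h1 := (quasiMeasurePreserving_rescale hab).ae_eq_comp h
  rw [Filter.EventuallyEq, ae_restrict_iff' measurableSet_Ico] at h1
  filter_upwards [h1] with t ht
  by_cases hmem : t ∈ Set.Ico a b
  · simpa [compressFun, hmem] using ht hmem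
  · simp [compressFun, hmem]

/-- The compression `T_I : L_p → L_p` for `I = [a,b) ⊆ [0,1)`. -/
def compress (p : ℝ≥0∞) (a b : ℝ) (hab : a < b) : LpI p →ₗ[ℝ] LpI p where
  toFun f := (memLp_compressFun hab f).toLp
  map_add' f g := by
    rw [← MemLp.toLp_add]
    apply MemLp.toLp_congr
    refine (compressFun_congr hab (Lp.coeFn_add f g)).trans (Eventually.of_forall fun t => ?_)
    by_cases hmem : t ∈ Set.Ico a b <;> simp [compressFun, hmem]
  map_smul' c f := by
    rw [RingHom.id_apply, ← MemLp.toLp_const_smul]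
    apply MemLp.toLp_congr
    refine (compressFun_congr hab (Lp.coeFn_smul c f)).trans (Eventually.of_forall fun t => ?_)
    by_cases hmem : t ∈ Set.Ico a b <;> simp [compressFun, hmem]

/-! ### Dyadic intervals and the Haar system -/

/-- A dyadic interval `[i/2^n, (i+1)/2^n)` of `[0,1)`, where `0 ≤ i < 2^n`. -/
@[ext]
structure Dyadic where
  /-- The exponent `n`: the interval belongs to `𝒟^n`. -/
  level : ℕ
  /-- The position `i`, counted from `0`. -/
  idx : ℕ
  idx_lt : idx < 2 ^ level

namespace Dyadic

/-- The left endpoint (the minimum) of the interval. -/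
def left (I : Dyadic) : ℝ := (I.idx : ℝ) / 2 ^ I.level

/-- The right endpoint of the interval. -/
def right (I : Dyadic) : ℝ := ((I.idx : ℝ) + 1) / 2 ^ I.level

theorem left_lt_right (I : Dyadic) : I.left < I.right := by
  unfold left right
  gcongr
  linarith

/-- The interval as a set of reals. -/
def toSet (I : Dyadic) : Set ℝ := Set.Ico I.left I.right

/-- The left half `I⁺`. -/
def plus (I : Dyadic) : Dyadic :=
  ⟨I.level + 1, 2 * I.idx, by have := I.idx_lt; rw [pow_succ]; omega⟩

/-- The right half `I⁻`. -/
def minus (I : Dyadic) : Dyadic :=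
  ⟨I.level + 1, 2 * I.idx + 1, by have := I.idx_lt; rw [pow_succ]; omega⟩

/-- The lexicographic order on dyadic intervals. -/
def LexLT (I J : Dyadic) : Prop :=
  I.level < J.level ∨ (I.level = J.level ∧ I.left < J.left)

/-- The characteristic function `χ_I` as an element of `L_p`. -/
def char (p : ℝ≥0∞) (I : Dyadic) : LpI p :=
  indicatorConstLp p (s := I.toSet) measurableSet_Ico (measure_ne_top unitMeasure _) (1 : ℝ)

/-- The Haar function `h_I = χ_{I⁺} - χ_{I⁻}`. -/
def haar (p : ℝ≥0∞) (I : Dyadic) : LpI p := I.plus.char p - I.minus.char p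

/-- The compression `T_I : L_p → L_p`. -/
def T (p : ℝ≥0∞) (I : Dyadic) : LpI p →ₗ[ℝ] LpI p := compress p I.left I.right I.left_lt_right

end Dyadic

/-- `L_p^{n,0}`: the mean-zero functions in the span of `(χ_I)_{I ∈ 𝒟^n}`. -/
def dyadicMeanZero (p : ℝ≥0∞) [Fact (1 ≤ p)] (n : ℕ) : Submodule ℝ (LpI p) :=
  Submodule.span ℝ (Dyadic.char p '' {I : Dyadic | I.level = n}) ⊓ meanZero p

/-! ### The spaces `R_α^p` and `R_α^{p,0}` -/

/-- A distributional embedding of `L_p` into itself: `dist (S f) = dist f` for every `f`. -/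
def IsDistributionalEmbedding {p : ℝ≥0∞} (S : LpI p →ₗ[ℝ] LpI p) : Prop :=
  ∀ f : LpI p, Measure.map (S f) unitMeasure = Measure.map f unitMeasure

/-- For every countable limit ordinal `α`, the operators `T α β : L_p → L_p`, `0 ≤ β < α`, are
distributional embeddings with independent ranges. (The other `T α β` are irrelevant.) -/
def IsIndependentSystem {p : ℝ≥0∞} (T : Ordinal.{0} → Ordinal.{0} → LpI p →ₗ[ℝ] LpI p) : Prop :=
  ∀ α : Ordinal.{0}, α < ω₁ → Order.IsSuccLimit α →
    (∀ β < α, IsDistributionalEmbedding (T α β)) ∧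
    ∀ f : Set.Iio α → LpI p,
      iIndepFun (fun (β : Set.Iio α) (t : ℝ) => T α β (f β) t) unitMeasure

/-- The Bourgain-Rosenthal-Schechtman space `R_α^p ⊆ L_p[0,1]`: the constants for `α = 0`,
`R_{β+1}^p = T_{[0,1/2)}(R_β^p) + T_{[1/2,1)}(R_β^p)`, and for limit `α` the closed linear span of
the `T α β (R_β^p)`, `β < α`. -/
def R {p : ℝ≥0∞} [Fact (1 ≤ p)] (T : Ordinal.{0} → Ordinal.{0} → LpI p →ₗ[ℝ] LpI p)
    (α : Ordinal.{0}) : Submodule ℝ (LpI p) :=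
  Ordinal.limitRecOn α
    (Submodule.span ℝ {Lp.const p unitMeasure (1 : ℝ)})
    (fun _ Rβ =>
      Rβ.map (compress p 0 (1 / 2) (by norm_num)) ⊔ Rβ.map (compress p (1 / 2) 1 (by norm_num)))
    (fun α _ Rlt =>
      (⨆ β : Set.Iio α, (Rlt β.1 β.2).map (T α β)).topologicalClosure)

/-- `R_α^{p,0}`: the mean-zero functions in `R_α^p`. -/
def R0 {p : ℝ≥0∞} [Fact (1 ≤ p)] (T : Ordinal.{0} → Ordinal.{0} → LpI p →ₗ[ℝ] LpI p)
    (α : Ordinal.{0}) : Submodule ℝ (LpI p) :=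
  R T α ⊓ meanZero p

/-! ### The trees `𝒯_α` -/

/-- The integer part `κ(α)` of an ordinal: `α = β + κ(α)` with `β` zero or a limit. -/
def kappa (α : Ordinal.{0}) : ℕ :=
  Ordinal.limitRecOn α 0 (fun _ k => k + 1) (fun _ _ _ => 0)

/-- The entries of the finite sequences in `𝒯_α`: ordinals and dyadic intervals. -/
inductive Entry : Type 1
  | ord (α : Ordinal.{0}) : Entry
  | int (I : Dyadic) : Entry

/-- `InTree α lam` means that the finite sequence `lam` belongs to `𝒯_α`. The constructors `head`
and `branch` concern successor ordinals `α = β + κ(α)` (then `β` is zero or a limit); for finite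
`α`, `branch` is void, since `𝒯_0` is empty. -/
inductive InTree : Ordinal.{0} → List Entry → Prop
  | head (α : Ordinal.{0}) : kappa α ≠ 0 → InTree α [Entry.ord α]
  | branch (α β : Ordinal.{0}) (I : Dyadic) (mu : List Entry) :
      kappa α ≠ 0 → α = β + (kappa α : Ordinal.{0}) → I.level = kappa α → InTree β mu →
      InTree α (Entry.ord α :: Entry.int I :: mu)
  | limit (α β : Ordinal.{0}) (mu : List Entry) :
      Order.IsSuccLimit α → 1 ≤ β → β < α → InTree β mu →
      InTree α (Entry.ord α :: mu)

/-- The tree `𝒯_α`; its order is the initial-segment order `<+:` of lists. -/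
def tree (α : Ordinal.{0}) : Set (List Entry) := {lam | InTree α lam}

/-- `κ(λ)`: the integer part of the last entry of `λ`. -/
def kappaSeq (lam : List Entry) : ℕ :=
  match lam.getLast? with
  | some (Entry.ord α) => kappa α
  | _ => 0

/-- The operator `T_λ : L_p → L_p`: `T_{(α)⌢μ} = T α β ∘ T_μ` when `μ` starts with the ordinal `β`,
`T_{(α,I)⌢μ} = T_I ∘ T_μ`, and `T_{(α)} = id`. -/
def opSeq {p : ℝ≥0∞} (T : Ordinal.{0} → Ordinal.{0} → LpI p →ₗ[ℝ] LpI p) :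
    List Entry → (LpI p →ₗ[ℝ] LpI p)
  | Entry.ord α :: Entry.ord β :: l => (T α β).comp (opSeq T (Entry.ord β :: l))
  | Entry.ord _ :: Entry.int I :: l => (I.T p).comp (opSeq T l)
  | _ => LinearMap.id

/-- `h_I^λ = T_λ(h_I)`. -/
def haarSeq {p : ℝ≥0∞} (T : Ordinal.{0} → Ordinal.{0} → LpI p →ₗ[ℝ] LpI p)
    (lam : List Entry) (I : Dyadic) : LpI p :=
  opSeq T lam (I.haar p)

/-- `X_λ = T_λ(L_p^{κ(λ),0})`. -/
def X {p : ℝ≥0∞} [Fact (1 ≤ p)] (T : Ordinal.{0} → Ordinal.{0} → LpI p →ₗ[ℝ] LpI p)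
    (lam : List Entry) : Submodule ℝ (LpI p) :=
  (dyadicMeanZero p (kappaSeq lam)).map (opSeq T lam)

/-- The set of pairs `(λ, I)` with `λ ∈ 𝒯_α` and `I ∈ 𝒟_{κ(λ)-1} = ⋃_{k < κ(λ)} 𝒟^k`. -/
def haarIndex (α : Ordinal.{0}) : Set (List Entry × Dyadic) :=
  {x | x.1 ∈ tree α ∧ x.2.level < kappaSeq x.1}

/-- `(s n)_{n < N}`, `N ∈ ℕ ∪ {∞}`, enumerates the set `S` without repetition. -/
def Enumerates {ι : Type*} (N : ℕ∞) (s : ℕ → ι) (S : Set ι) : Prop :=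
  Set.BijOn s {n : ℕ | (n : ℕ∞) < N} S

/-- For `n < m < N`: `λ_n`, `λ_m` are incomparable, or `λ_n` is a proper initial segment of `λ_m`, or
`λ_n = λ_m` and `I_n < I_m` lexicographically. -/
def Compatible (N : ℕ∞) (lam : ℕ → List Entry) (I : ℕ → Dyadic) : Prop :=
  ∀ n m : ℕ, n < m → (m : ℕ∞) < N →
    (¬ lam n <+: lam m ∧ ¬ lam m <+: lam n) ∨
    (lam n <+: lam m ∧ lam n ≠ lam m) ∨
    (lam n = lam m ∧ (I n).LexLT (I m))

/-! ### Martingale difference sequences, bases and decompositions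

Sequences have length `N ∈ ℕ ∪ {∞}` and are written `(e n)_{n < N}`; terms with `n ≥ N` are never
used. -/

/-- `(f n)_{n < N}` is a martingale difference sequence: `𝔼(f n | f 0, …, f (n-1)) = 0` for all
`1 ≤ n < N`. -/
def IsMDS {p : ℝ≥0∞} (N : ℕ∞) (f : ℕ → LpI p) : Prop :=
  ∀ n : ℕ, 1 ≤ n → (n : ℕ∞) < N →
    unitMeasure[(f n : ℝ → ℝ) |
      ⨆ k : Fin n, MeasurableSpace.comap (f k : ℝ → ℝ) (borel ℝ)] =ᵐ[unitMeasure] 0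

section Bases

variable {E : Type*} [NormedAddCommGroup E] [NormedSpace ℝ E]

/-- The closed linear span of `(e n)_{n < N}`. -/
def closedSpan (N : ℕ∞) (e : ℕ → E) : Submodule ℝ E :=
  (Submodule.span ℝ (e '' {n : ℕ | (n : ℕ∞) < N})).topologicalClosure

/-- `(e n)_{n < N}` is a Schauder basis of the subspace `Y`: the `e n` lie in `Y` and every `x ∈ Y`
has a unique expansion `x = ∑_{n < N} a n • e n`. -/
def IsSchauderBasis (N : ℕ∞) (Y : Submodule ℝ E) (e : ℕ → E) : Prop :=
  (∀ n : ℕ, (n : ℕ∞) < N → e n ∈ Y) ∧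
  ∀ x ∈ Y, ∃! a : ℕ → ℝ, (∀ n : ℕ, N ≤ (n : ℕ∞) → a n = 0) ∧
    Tendsto (fun k : ℕ => ∑ n ∈ Finset.range k, a n • e n) atTop (𝓝 x)

/-- `(e n)_{n < N}` is an unconditional Schauder basis of `Y`. -/
def IsUnconditionalBasis (N : ℕ∞) (Y : Submodule ℝ E) (e : ℕ → E) : Prop :=
  IsSchauderBasis N Y e ∧
  ∃ C : ℝ, 1 ≤ C ∧ ∀ k : ℕ, (k : ℕ∞) ≤ N → ∀ a b : ℕ → ℝ, (∀ n < k, |a n| ≤ |b n|) →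
    ‖∑ n ∈ Finset.range k, a n • e n‖ ≤ C * ‖∑ n ∈ Finset.range k, b n • e n‖

/-- `(F n)_{n < N}` is a Schauder decomposition of `Y`: the `F n` are closed subspaces of `Y` and
every `x ∈ Y` is uniquely `x = ∑_{n < N} y n` with `y n ∈ F n`. -/
def IsSchauderDecomposition (N : ℕ∞) (Y : Submodule ℝ E) (F : ℕ → Submodule ℝ E) : Prop :=
  (∀ n : ℕ, (n : ℕ∞) < N → F n ≤ Y ∧ IsClosed (F n : Set E)) ∧
  ∀ x ∈ Y, ∃! y : ℕ → E, (∀ n : ℕ, (n : ℕ∞) < N → y n ∈ F n) ∧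
    (∀ n : ℕ, N ≤ (n : ℕ∞) → y n = 0) ∧
    Tendsto (fun k : ℕ => ∑ n ∈ Finset.range k, y n) atTop (𝓝 x)

/-- `(F n)_{n < N}` is an unconditional finite-dimensional decomposition (FDD) of `Y`: a Schauder
decomposition into finite-dimensional subspaces such that all nonzero `x n ∈ F n` form an
unconditional basis of their closed linear span. -/
def IsUnconditionalFDD (N : ℕ∞) (Y : Submodule ℝ E) (F : ℕ → Submodule ℝ E) : Prop :=
  IsSchauderDecomposition N Y F ∧
  (∀ n : ℕ, (n : ℕ∞) < N → FiniteDimensional ℝ (F n)) ∧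
  ∀ x : ℕ → E, (∀ n : ℕ, (n : ℕ∞) < N → x n ∈ F n ∧ x n ≠ 0) →
    IsUnconditionalBasis N (closedSpan N x) x

end Bases

end BRS

end

/-!
A Haar function `h_J^μ` of the system either lives on a piece of `[0, 1)` on which an earlier
`h_I^λ` is constant, and has mean zero there, or is independent of it. Applied jointly to all
earlier functions, this makes the system a martingale difference sequence.

For `1 < p < ∞` such sequences are unconditional by Burkholder's inequality, which comes from a
function `U` of the two martingales `f = ∑ dₙ` and `g = ∑ aₙ dₙ`, `|aₙ| ≤ 1`, that majorizes
`|g|^p - C (1 + |f|^p)` and is concave along all lines of direction `(1, ε)`, `|ε| ≤ 1`. By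
concavity `E U(f, g) ≤ U(0, 0)`, and the constant terms disappear on replacing `d` by `s d` and
letting `s → ∞`.

The closed span is found by induction on `α`: at `β + κ(α)` the space splits into the mean-zero
functions constant on the dyadic intervals of level `κ(α)` and copies of `R_β^{p,0}` on these
intervals, while at a limit ordinal centring the generating spaces is enough. Grouping an
unconditional basis into finite blocks gives an unconditional FDD.
-/

noncomputable section

namespace BRS

/-! ### Burkholder's inequality -/

theorem le_tangent_of_deriv2_nonpos {G G' G'' : ℝ → ℝ} (hG : ∀ t, HasDerivAt G (G' t) t)
    (hG' : ∀ t, HasDerivAt G' (G'' t) t) (hG'' : ∀ t, G'' t ≤ 0) (s t : ℝ) :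
    G t ≤ G s + G' s * (t - s) := by
  have hconc : ConcaveOn ℝ Set.univ G := concaveOn_of_hasDerivWithinAt2_nonpos convex_univ
    (HasDerivAt.continuousOn fun t _ => hG t) (fun t _ => (hG t).hasDerivWithinAt)
    (fun t _ => (hG' t).hasDerivWithinAt) fun t _ => hG'' t
  rcases lt_trichotomy s t with hst | rfl | hst
  · have h := hconc.slope_le_of_hasDerivAt (Set.mem_univ s) (Set.mem_univ t) hst (hG s)
    rw [slope_def_field, div_le_iff₀ (sub_pos.2 hst)] at h
    linarith
  · simp
  · have h := hconc.le_slope_of_hasDerivAt (Set.mem_univ t) (Set.mem_univ s) hst (hG s)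
    rw [slope_def_field, le_div_iff₀ (sub_pos.2 hst)] at h
    linarith

theorem hasDerivAt_deriv_rpow {q q' : ℝ → ℝ} {q'' t : ℝ} (hq : HasDerivAt q (q' t) t)
    (hq' : HasDerivAt q' q'' t) (hpos : 0 < q t) (r : ℝ) :
    HasDerivAt (fun t => r * q t ^ (r - 1) * q' t)
      (r * q t ^ (r - 2) * ((r - 1) * q' t ^ 2 + q t * q'')) t := by
  have h := ((hq.rpow_const (p := r - 1) (Or.inl hpos.ne')).const_mul r).mul hq'
  refine h.congr_deriv ?_
  have hsplit : q t ^ (r - 1) = q t ^ (r - 2) * q t := by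
    rw [← Real.rpow_add_one hpos.ne']
    ring_nf
  rw [hsplit, show r - 1 - 1 = r - 2 by ring]
  ring

section SecondDerivativeBounds

variable {r q q' q'' : ℝ}

theorem second_deriv_rpow_le (hr : 0 ≤ r) (hq : 0 < q) (h : q' ^ 2 ≤ 2 * q * q'') :
    r * q ^ (r - 2) * ((r - 1) * q' ^ 2 + q * q'') ≤ r * max 1 (2 * r - 1) * q'' * q ^ (r - 1) := by
  have hbracket : (r - 1) * q' ^ 2 + q * q'' ≤ max 1 (2 * r - 1) * q'' * q := by
    rcases le_total r 1 with hr1 | hr1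
    · rw [max_eq_left (by linarith)]
      nlinarith [sq_nonneg q']
    · rw [max_eq_right (by linarith)]
      nlinarith [sq_nonneg q']
  calc r * q ^ (r - 2) * ((r - 1) * q' ^ 2 + q * q'')
      ≤ r * q ^ (r - 2) * (max 1 (2 * r - 1) * q'' * q) := by gcongr
    _ = r * max 1 (2 * r - 1) * q'' * (q ^ (r - 2) * q) := by ring
    _ = r * max 1 (2 * r - 1) * q'' * q ^ (r - 1) := by
        rw [← Real.rpow_add_one hq.ne']
        ring_nf

theorem le_second_deriv_rpow (hr : 0 ≤ r) (hq : 0 < q) (h : q' ^ 2 ≤ 2 * q * q'') :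
    r * min 1 (2 * r - 1) * q'' * q ^ (r - 1) ≤ r * q ^ (r - 2) * ((r - 1) * q' ^ 2 + q * q'') := by
  have hbracket : min 1 (2 * r - 1) * q'' * q ≤ (r - 1) * q' ^ 2 + q * q'' := by
    rcases le_total r 1 with hr1 | hr1
    · rw [min_eq_right (by linarith)]
      nlinarith [sq_nonneg q']
    · rw [min_eq_left (by linarith)]
      nlinarith [sq_nonneg q']
  calc r * min 1 (2 * r - 1) * q'' * q ^ (r - 1)
      = r * min 1 (2 * r - 1) * q'' * (q ^ (r - 2) * q) := by
        rw [← Real.rpow_add_one hq.ne']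
        ring_nf
    _ = r * q ^ (r - 2) * (min 1 (2 * r - 1) * q'' * q) := by ring
    _ ≤ r * q ^ (r - 2) * ((r - 1) * q' ^ 2 + q * q'') := by gcongr

end SecondDerivativeBounds

/-- The quadratic function `1 + x² + c y²`, from whose powers the Burkholder function is built. -/
def quad (c x y : ℝ) : ℝ := 1 + x ^ 2 + c * y ^ 2

/-- The derivative of `quad c` at `(x, y)` in the direction `(1, ε)`. -/
def quadDeriv (c ε x y : ℝ) : ℝ := 2 * (x + c * ε * y)

section Quad

variable {c : ℝ}

theorem quad_pos (hc : 0 ≤ c) (x y : ℝ) : 0 < quad c x y := by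
  unfold quad
  positivity

theorem hasDerivAt_quad (c ε x y t : ℝ) :
    HasDerivAt (fun t => quad c (x + t) (y + ε * t)) (quadDeriv c ε (x + t) (y + ε * t)) t := by
  have hx : HasDerivAt (fun t : ℝ => x + t) 1 t := (hasDerivAt_id t).const_add x
  have hy : HasDerivAt (fun t : ℝ => y + ε * t) ε t := by
    simpa using ((hasDerivAt_id t).const_mul ε).const_add y
  refine (((hx.pow 2).const_add 1).add ((hy.pow 2).const_mul c)).congr_deriv ?_
  simp only [quadDeriv, Nat.cast_ofNat]
  ring

theorem hasDerivAt_quadDeriv (c ε x y t : ℝ) :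
    HasDerivAt (fun t => quadDeriv c ε (x + t) (y + ε * t)) (2 * (1 + c * ε ^ 2)) t := by
  have hx : HasDerivAt (fun t : ℝ => x + t) 1 t := (hasDerivAt_id t).const_add x
  have hy : HasDerivAt (fun t : ℝ => y + ε * t) ε t := by
    simpa using ((hasDerivAt_id t).const_mul ε).const_add y
  exact ((hx.add (hy.const_mul (c * ε))).const_mul 2).congr_deriv (by ring)

theorem hasDerivAt_quad_rpow (hc : 0 ≤ c) (r ε x y t : ℝ) :
    HasDerivAt (fun t => quad c (x + t) (y + ε * t) ^ r)
      (r * quad c (x + t) (y + ε * t) ^ (r - 1) * quadDeriv c ε (x + t) (y + ε * t)) t :=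
  ((hasDerivAt_quad c ε x y t).rpow_const (Or.inl (quad_pos hc _ _).ne')).congr_deriv (by ring)

theorem quadDeriv_sq_le (hc : 0 ≤ c) (ε x y : ℝ) :
    quadDeriv c ε x y ^ 2 ≤ 2 * quad c x y * (2 * (1 + c * ε ^ 2)) := by
  have hgap : 2 * quad c x y * (2 * (1 + c * ε ^ 2)) - quadDeriv c ε x y ^ 2 =
      4 * ((1 + c * ε ^ 2) + c * (ε * x - y) ^ 2) := by
    unfold quadDeriv quad
    ring
  have hnonneg : 0 ≤ 4 * ((1 + c * ε ^ 2) + c * (ε * x - y) ^ 2) := by positivity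
  linarith

theorem continuous_quad_rpow (hc : 0 ≤ c) (r : ℝ) :
    Continuous fun z : ℝ × ℝ => quad c z.1 z.2 ^ r :=
  Continuous.rpow_const (by unfold quad; fun_prop) fun z => Or.inl (quad_pos hc z.1 z.2).ne'

end Quad

theorem add_add_rpow_le {a b c r : ℝ} (ha : 0 ≤ a) (hb : 0 ≤ b) (hc : 0 ≤ c) (hr : 0 ≤ r) :
    (a + b + c) ^ r ≤ 3 ^ r * (a ^ r + b ^ r + c ^ r) := by
  have hmax : max a (max b c) ^ r ≤ a ^ r + b ^ r + c ^ r := by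
    have har : 0 ≤ a ^ r := by positivity
    have hbr : 0 ≤ b ^ r := by positivity
    have hcr : 0 ≤ c ^ r := by positivity
    rcases max_choice a (max b c) with h | h
    · rw [h]
      linarith
    · rcases max_choice b c with h' | h' <;> rw [h, h'] <;> linarith
  calc (a + b + c) ^ r ≤ (3 * max a (max b c)) ^ r := by
        gcongr
        linarith [le_max_left a (max b c), (le_max_left b c).trans (le_max_right a _),
          (le_max_right b c).trans (le_max_right a _)]
    _ = 3 ^ r * max a (max b c) ^ r := Real.mul_rpow (by norm_num) (le_max_of_le_left ha)
    _ ≤ 3 ^ r * (a ^ r + b ^ r + c ^ r) := by gcongr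

theorem abs_rpow_two_mul (x r : ℝ) : |x| ^ (2 * r) = (x ^ 2) ^ r := by
  rw [Real.rpow_mul (abs_nonneg x), Real.rpow_two, sq_abs]

theorem quad_rpow_le {c r : ℝ} (hc : 0 ≤ c) (hr : 0 ≤ r) (x y : ℝ) :
    quad c x y ^ r ≤ 3 ^ r * (1 + |x| ^ (2 * r) + c ^ r * |y| ^ (2 * r)) := by
  rw [abs_rpow_two_mul, abs_rpow_two_mul, ← Real.mul_rpow hc (sq_nonneg y)]
  simpa [quad] using add_add_rpow_le zero_le_one (sq_nonneg x) (mul_nonneg hc (sq_nonneg y)) hr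

/-- A scale `L` for which `burkholderFun r L` is concave in the directions `(1, ε)`, `|ε| ≤ 1`. -/
structure IsAdmissibleScale (r L : ℝ) : Prop where
  pos : 0 < L
  le_one : L ≤ 1
  dominates : ∀ s S : ℝ, 0 < S → L * S ≤ s → s ≤ S →
    4 * max 1 (2 * r - 1) * S ^ (r - 1) ≤ (3 * L) ^ (-r) * min 1 (2 * r - 1) * s ^ (r - 1)

theorem exists_rpow_dominates {r : ℝ} (hr : 0 < r) (Q : ℝ) :
    ∃ L : ℝ, 0 < L ∧ L ≤ 1 ∧ ∀ s S : ℝ, 0 < S → L * S ≤ s → s ≤ S →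
      Q * S ^ (r - 1) ≤ L ^ (-r) * s ^ (r - 1) := by
  obtain ⟨L, ⟨hL0, hL1⟩, hLr, hLinv⟩ := ((eventually_mem_set.2 (Ioc_mem_nhdsGT one_pos)).and
    (((tendsto_rpow_neg_nhdsGT_zero (neg_lt_zero.2 hr)).eventually_ge_atTop Q).and
      (tendsto_inv_nhdsGT_zero.eventually_ge_atTop Q))).exists
  refine ⟨L, hL0, hL1, fun s S hS hLs hsS => ?_⟩
  rcases le_total r 1 with hr1 | hr1
  · have hs : 0 < s := lt_of_lt_of_le (by positivity) hLs
    have hpow : S ^ (r - 1) ≤ s ^ (r - 1) :=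
      Real.rpow_le_rpow_of_nonpos hs hsS (by linarith)
    gcongr
  · calc Q * S ^ (r - 1) ≤ L⁻¹ * S ^ (r - 1) := by gcongr
      _ = L ^ (-r) * (L * S) ^ (r - 1) := by
          rw [Real.mul_rpow hL0.le hS.le, ← mul_assoc, ← Real.rpow_add hL0,
            show -r + (r - 1) = -1 by ring, Real.rpow_neg_one]
      _ ≤ L ^ (-r) * s ^ (r - 1) := by gcongr

theorem exists_isAdmissibleScale {r : ℝ} (hr : 1 / 2 < r) : ∃ L, IsAdmissibleScale r L := by
  have hm : 0 < min 1 (2 * r - 1) := lt_min one_pos (by linarith)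
  obtain ⟨L, hL0, hL1, hL⟩ := exists_rpow_dominates (by linarith : 0 < r)
    (3 ^ r * (4 * max 1 (2 * r - 1)) / min 1 (2 * r - 1))
  refine ⟨L, hL0, hL1, fun s S hS hLs hsS => ?_⟩
  have h := hL s S hS hLs hsS
  rw [div_mul_eq_mul_div, div_le_iff₀ hm, mul_assoc] at h
  rw [Real.mul_rpow (by norm_num) hL0.le, Real.rpow_neg (by norm_num) r]
  calc 4 * max 1 (2 * r - 1) * S ^ (r - 1)
      ≤ (3 ^ r)⁻¹ * (L ^ (-r) * s ^ (r - 1) * min 1 (2 * r - 1)) := by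
        rwa [le_inv_mul_iff₀ (by positivity)]
    _ = (3 ^ r)⁻¹ * L ^ (-r) * min 1 (2 * r - 1) * s ^ (r - 1) := by ring

/-- A smooth Burkholder function for the exponent `p = 2r`: it majorizes `|y|^p - C (1 + |x|^p)` and
is concave along every line of direction `(1, ε)` with `|ε| ≤ 1`. -/
def burkholderFun (r L x y : ℝ) : ℝ := 2 * quad 1 x y ^ r - (3 * L) ^ (-r) * quad L x y ^ r

/-- The derivative of `burkholderFun r L` at `(x, y)` in the direction `(1, ε)`. -/
def burkholderFunDeriv (r L ε x y : ℝ) : ℝ :=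
  2 * (r * quad 1 x y ^ (r - 1) * quadDeriv 1 ε x y) -
    (3 * L) ^ (-r) * (r * quad L x y ^ (r - 1) * quadDeriv L ε x y)

namespace IsAdmissibleScale

variable {r L ε : ℝ}

theorem second_deriv_nonpos (hL : IsAdmissibleScale r L) (hr : 1 / 2 < r) (hε : |ε| ≤ 1)
    (x y : ℝ) :
    2 * (r * quad 1 x y ^ (r - 2) *
        ((r - 1) * quadDeriv 1 ε x y ^ 2 + quad 1 x y * (2 * (1 + 1 * ε ^ 2)))) -
      (3 * L) ^ (-r) * (r * quad L x y ^ (r - 2) *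
        ((r - 1) * quadDeriv L ε x y ^ 2 + quad L x y * (2 * (1 + L * ε ^ 2)))) ≤ 0 := by
  have hr0 : 0 < r := by linarith
  have hL0 := hL.pos
  have hS := quad_pos zero_le_one x y
  have hs := quad_pos hL0.le x y
  have hm : 0 ≤ min 1 (2 * r - 1) := le_min zero_le_one (by linarith)
  have hε2 : ε ^ 2 ≤ 1 := (sq_le_one_iff_abs_le_one ε).2 hε
  have hupper := second_deriv_rpow_le hr0.le hS (quadDeriv_sq_le zero_le_one ε x y)
  have hlower := le_second_deriv_rpow hr0.le hs (quadDeriv_sq_le hL0.le ε x y)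
  have hdom := hL.dominates (quad L x y) (quad 1 x y) hS
    (by unfold quad; nlinarith [hL.le_one, sq_nonneg x, sq_nonneg y])
    (by unfold quad; nlinarith [hL.le_one, sq_nonneg y])
  rw [sub_nonpos]
  calc _ ≤ 2 * (r * max 1 (2 * r - 1) * (2 * (1 + 1 * 1)) * quad 1 x y ^ (r - 1)) := by
        grw [hupper, hε2]
    _ = 2 * r * (4 * max 1 (2 * r - 1) * quad 1 x y ^ (r - 1)) := by ring
    _ ≤ 2 * r * ((3 * L) ^ (-r) * min 1 (2 * r - 1) * quad L x y ^ (r - 1)) := by gcongr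
    _ = (3 * L) ^ (-r) * (r * min 1 (2 * r - 1) * (2 * (1 + 0)) * quad L x y ^ (r - 1)) := by ring
    _ ≤ _ := by
        grw [← hlower]
        gcongr
        positivity

theorem burkholderFun_le_tangent (hL : IsAdmissibleScale r L) (hr : 1 / 2 < r) (hε : |ε| ≤ 1)
    (x y t : ℝ) :
    burkholderFun r L (x + t) (y + ε * t) ≤
      burkholderFun r L x y + burkholderFunDeriv r L ε x y * t := by
  have hderiv₂ {c : ℝ} (hc : 0 ≤ c) (t : ℝ) := hasDerivAt_deriv_rpow
    (q := fun t => quad c (x + t) (y + ε * t)) (hasDerivAt_quad c ε x y t)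
    (hasDerivAt_quadDeriv c ε x y t) (quad_pos hc _ _) r
  simpa using le_tangent_of_deriv2_nonpos
    (G := fun t => burkholderFun r L (x + t) (y + ε * t))
    (G' := fun t => burkholderFunDeriv r L ε (x + t) (y + ε * t))
    (fun t => ((hasDerivAt_quad_rpow zero_le_one r ε x y t).const_mul 2).sub
      ((hasDerivAt_quad_rpow hL.pos.le r ε x y t).const_mul _))
    (fun t => ((hderiv₂ zero_le_one t).const_mul 2).sub ((hderiv₂ hL.pos.le t).const_mul _))
    (fun t => hL.second_deriv_nonpos hr hε _ _) 0 t

theorem abs_rpow_le_burkholderFun_add (hL : IsAdmissibleScale r L) (hr : 0 ≤ r) (x y : ℝ) :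
    |y| ^ (2 * r) ≤ burkholderFun r L x y + L ^ (-r) * (1 + |x| ^ (2 * r)) := by
  have hL0 := hL.pos
  have hy : |y| ^ (2 * r) ≤ quad 1 x y ^ r := by
    rw [abs_rpow_two_mul]
    refine Real.rpow_le_rpow (sq_nonneg y) ?_ hr
    unfold quad
    nlinarith [sq_nonneg x]
  have hquad :
      (3 * L) ^ (-r) * quad L x y ^ r ≤ L ^ (-r) * (1 + |x| ^ (2 * r)) + |y| ^ (2 * r) := by
    calc (3 * L) ^ (-r) * quad L x y ^ r
        ≤ (3 * L) ^ (-r) * (3 ^ r * (1 + |x| ^ (2 * r) + L ^ r * |y| ^ (2 * r))) := by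
          grw [quad_rpow_le hL0.le hr]
      _ = L ^ (-r) * (1 + |x| ^ (2 * r)) + |y| ^ (2 * r) := by
          rw [Real.mul_rpow (by norm_num) hL0.le, Real.rpow_neg (by norm_num), Real.rpow_neg hL0.le]
          have h3 : (3 : ℝ) ^ r ≠ 0 := by positivity
          have hLr : L ^ r ≠ 0 := by positivity
          field_simp
  unfold burkholderFun
  linarith

end IsAdmissibleScale

theorem continuous_burkholderFunDeriv {L : ℝ} (hL : 0 ≤ L) (r ε : ℝ) :
    Continuous fun z : ℝ × ℝ => burkholderFunDeriv r L ε z.1 z.2 := by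
  have hS := continuous_quad_rpow zero_le_one (r - 1)
  have hs := continuous_quad_rpow hL (r - 1)
  unfold burkholderFunDeriv quadDeriv
  fun_prop

section Martingale

variable {Ω : Type*} {mΩ : MeasurableSpace Ω} {P : Measure Ω}

theorem integrable_abs_rpow {s : ℝ} (hs : 0 ≤ s) {f : Ω → ℝ} [IsFiniteMeasure P]
    (hf : MemLp f (ENNReal.ofReal s) P) : Integrable (fun w => |f w| ^ s) P := by
  have h := hf.integrable_norm_rpow'
  rwa [ENNReal.toReal_ofReal hs] at h

section Integrability

variable [IsFiniteMeasure P] {r c L ε : ℝ} {f g d : Ω → ℝ}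

theorem integrable_quad_rpow (hc : 0 ≤ c) (hr : 0 < r) (hf : MemLp f (ENNReal.ofReal (2 * r)) P)
    (hg : MemLp g (ENNReal.ofReal (2 * r)) P) :
    Integrable (fun w => quad c (f w) (g w) ^ r) P := by
  have hbound : Integrable
      (fun w => 3 ^ r * (1 + |f w| ^ (2 * r) + c ^ r * |g w| ^ (2 * r))) P :=
    (((integrable_const 1).add (integrable_abs_rpow (by positivity) hf)).add
      ((integrable_abs_rpow (by positivity) hg).const_mul _)).const_mul _
  have hmeas := (continuous_quad_rpow hc r).comp_aestronglyMeasurable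
    (hf.aestronglyMeasurable.prodMk hg.aestronglyMeasurable)
  refine hbound.mono' hmeas (Eventually.of_forall fun w => ?_)
  rw [Real.norm_of_nonneg (Real.rpow_nonneg (quad_pos hc _ _).le _)]
  exact quad_rpow_le hc hr.le (f w) (g w)

theorem integrable_burkholderFun (hL : 0 ≤ L) (hr : 0 < r)
    (hf : MemLp f (ENNReal.ofReal (2 * r)) P) (hg : MemLp g (ENNReal.ofReal (2 * r)) P) :
    Integrable (fun w => burkholderFun r L (f w) (g w)) P :=
  ((integrable_quad_rpow zero_le_one hr hf hg).const_mul 2).sub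
    ((integrable_quad_rpow hL hr hf hg).const_mul _)

theorem integrable_burkholderFunDeriv_mul (hL : IsAdmissibleScale r L) (hr : 1 / 2 < r)
    (hε : |ε| ≤ 1) (hf : MemLp f (ENNReal.ofReal (2 * r)) P)
    (hg : MemLp g (ENNReal.ofReal (2 * r)) P) (hd : MemLp d (ENNReal.ofReal (2 * r)) P) :
    Integrable (fun w => burkholderFunDeriv r L ε (f w) (g w) * d w) P := by
  have hU : ∀ s : ℝ, Integrable
      (fun w => |burkholderFun r L (f w + s * d w) (g w + ε * (s * d w))|) P := fun s =>
    (integrable_burkholderFun hL.pos.le (by linarith) (hf.add (hd.const_mul s))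
      (hg.add ((hd.const_mul s).const_mul ε))).abs
  refine (((hU 1).add (hU (-1))).add (hU 0)).mono'
    (((continuous_burkholderFunDeriv hL.pos.le r ε).comp_aestronglyMeasurable
      (hf.aestronglyMeasurable.prodMk hg.aestronglyMeasurable)).mul hd.aestronglyMeasurable)
    (Eventually.of_forall fun w => ?_)
  have htangent := fun s => hL.burkholderFun_le_tangent hr hε (f w) (g w) (s * d w)
  have hplus := htangent 1
  have hminus := htangent (-1)
  simp only [Pi.add_apply, Real.norm_eq_abs, one_mul, zero_mul, mul_zero, add_zero, neg_mul,
    mul_neg] at hplus hminus ⊢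
  grind

end Integrability

theorem integral_mul_eq_zero_of_condExp_eq_zero [IsFiniteMeasure P] {m : MeasurableSpace Ω}
    (hm : m ≤ mΩ) {f d : Ω → ℝ} (hf : StronglyMeasurable[m] f)
    (hfd : Integrable (fun w => f w * d w) P) (hd : Integrable d P) (hd0 : P[d | m] =ᵐ[P] 0) :
    ∫ w, f w * d w ∂P = 0 := by
  have hcond : P[f * d | m] =ᵐ[P] 0 := by
    filter_upwards [condExp_mul_of_stronglyMeasurable_left hf hfd hd, hd0] with w hw hw0
    simp [hw, hw0]
  calc ∫ w, f w * d w ∂P = ∫ w, (P[f * d | m]) w ∂P := (integral_condExp hm).symm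
    _ = 0 := by simp [integral_congr_ae hcond]

/-- `d 0, …, d (k - 1)` are martingale differences in `L_p(P)`, where `m n` plays the role of the
past of `d n`. There is no condition on the mean of `d 0`. -/
structure IsLpMDS (P : Measure Ω) (p : ℝ≥0∞) (m : ℕ → MeasurableSpace Ω) (k : ℕ)
    (d : ℕ → Ω → ℝ) : Prop where
  memLp : ∀ n < k, MemLp (d n) p P
  le : ∀ n < k, m n ≤ mΩ
  stronglyMeasurable : ∀ n < k, ∀ i < n, StronglyMeasurable[m n] (d i)
  condExp_eq_zero : ∀ n < k, 1 ≤ n → P[d n | m n] =ᵐ[P] 0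

namespace IsLpMDS

variable {p : ℝ≥0∞} {m : ℕ → MeasurableSpace Ω} {k : ℕ} {d : ℕ → Ω → ℝ}

theorem mono {l : ℕ} (hd : IsLpMDS P p m k d) (hl : l ≤ k) : IsLpMDS P p m l d where
  memLp n hn := hd.memLp n (hn.trans_le hl)
  le n hn := hd.le n (hn.trans_le hl)
  stronglyMeasurable n hn := hd.stronglyMeasurable n (hn.trans_le hl)
  condExp_eq_zero n hn := hd.condExp_eq_zero n (hn.trans_le hl)

theorem const_mul (hd : IsLpMDS P p m k d) (a : ℕ → ℝ) :
    IsLpMDS P p m k fun n w => a n * d n w where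
  memLp n hn := (hd.memLp n hn).const_mul (a n)
  le := hd.le
  stronglyMeasurable n hn i hi := (hd.stronglyMeasurable n hn i hi).const_mul (a i)
  condExp_eq_zero n hn hn1 := by
    filter_upwards [condExp_smul (a n) (d n) (m n) (μ := P), hd.condExp_eq_zero n hn hn1]
      with w hw hw0
    exact hw.trans (by simp [hw0])

theorem memLp_sum (hd : IsLpMDS P p m k d) : MemLp (fun w => ∑ n ∈ Finset.range k, d n w) p P :=
  memLp_finsetSum _ fun n hn => hd.memLp n (Finset.mem_range.1 hn)

theorem stronglyMeasurable_sum (hd : IsLpMDS P p m (k + 1) d) :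
    StronglyMeasurable[m k] fun w => ∑ n ∈ Finset.range k, d n w :=
  Finset.stronglyMeasurable_fun_sum _ fun n hn =>
    hd.stronglyMeasurable k k.lt_succ_self n (Finset.mem_range.1 hn)

theorem integral_burkholderFunDeriv_mul_eq_zero [IsFiniteMeasure P] {r L ε : ℝ}
    (hL : IsAdmissibleScale r L) (hr : 1 / 2 < r) (hε : |ε| ≤ 1)
    (hd : IsLpMDS P (ENNReal.ofReal (2 * r)) m (k + 1) d) (θ : ℕ → ℝ) :
    ∫ w, burkholderFunDeriv r L ε (∑ n ∈ Finset.range k, d n w)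
      (∑ n ∈ Finset.range k, θ n * d n w) * d k w ∂P = 0 := by
  have hk := k.lt_succ_self
  rcases Nat.eq_zero_or_pos k with rfl | hpos
  · simp [burkholderFunDeriv, quadDeriv]
  · have hp : 1 ≤ ENNReal.ofReal (2 * r) := by
      rw [ENNReal.one_le_ofReal]
      linarith
    have hmeas := (continuous_burkholderFunDeriv hL.pos.le r ε).comp_stronglyMeasurable
      (hd.stronglyMeasurable_sum.prodMk (hd.const_mul θ).stronglyMeasurable_sum)
    exact integral_mul_eq_zero_of_condExp_eq_zero (hd.le k hk) hmeas
      (integrable_burkholderFunDeriv_mul hL hr hε (hd.mono hk.le).memLp_sum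
        ((hd.const_mul θ).mono hk.le).memLp_sum (hd.memLp k hk))
      ((hd.memLp k hk).integrable hp) (hd.condExp_eq_zero k hk hpos)

theorem integral_burkholderFun_le [IsProbabilityMeasure P] {r L : ℝ}
    (hL : IsAdmissibleScale r L) (hr : 1 / 2 < r) {θ : ℕ → ℝ} (hθ : ∀ n, |θ n| ≤ 1)
    (hd : IsLpMDS P (ENNReal.ofReal (2 * r)) m k d) :
    ∫ w, burkholderFun r L (∑ n ∈ Finset.range k, d n w)
      (∑ n ∈ Finset.range k, θ n * d n w) ∂P ≤ 2 := by
  induction k with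
  | zero =>
    have hnonneg : 0 ≤ (3 * L) ^ (-r) := Real.rpow_nonneg (by linarith [hL.pos]) _
    simpa [burkholderFun, quad] using hnonneg
  | succ k ih =>
    have hpast := hd.mono k.le_succ
    have hint : ∀ {l}, IsLpMDS P (ENNReal.ofReal (2 * r)) m l d → Integrable (fun w =>
        burkholderFun r L (∑ n ∈ Finset.range l, d n w) (∑ n ∈ Finset.range l, θ n * d n w)) P :=
      fun h => integrable_burkholderFun hL.pos.le (by linarith) h.memLp_sum
        (h.const_mul θ).memLp_sum
    have hderiv := integrable_burkholderFunDeriv_mul hL hr (hθ k) hpast.memLp_sum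
      (hpast.const_mul θ).memLp_sum (hd.memLp k k.lt_succ_self)
    refine le_trans ?_ (ih hpast)
    calc _ ≤ ∫ w, (burkholderFun r L (∑ n ∈ Finset.range k, d n w)
              (∑ n ∈ Finset.range k, θ n * d n w) +
            burkholderFunDeriv r L (θ k) (∑ n ∈ Finset.range k, d n w)
              (∑ n ∈ Finset.range k, θ n * d n w) * d k w) ∂P := by
          refine integral_mono (hint hd) ((hint hpast).add hderiv) fun w => ?_
          simp only [Finset.sum_range_succ]
          exact hL.burkholderFun_le_tangent hr (hθ k) _ _ _
      _ = _ := by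
          rw [integral_add (hint hpast) hderiv,
            hd.integral_burkholderFunDeriv_mul_eq_zero hL hr (hθ k), add_zero]

theorem integral_abs_rpow_le_add [IsProbabilityMeasure P] {r L : ℝ}
    (hL : IsAdmissibleScale r L) (hr : 1 / 2 < r) {θ : ℕ → ℝ} (hθ : ∀ n, |θ n| ≤ 1)
    (hd : IsLpMDS P (ENNReal.ofReal (2 * r)) m k d) :
    ∫ w, |∑ n ∈ Finset.range k, θ n * d n w| ^ (2 * r) ∂P ≤
      2 + L ^ (-r) + L ^ (-r) * ∫ w, |∑ n ∈ Finset.range k, d n w| ^ (2 * r) ∂P := by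
  have hsum := hd.memLp_sum
  have htransform := (hd.const_mul θ).memLp_sum
  have hpow := integrable_abs_rpow (by linarith) hsum
  have hU := integrable_burkholderFun hL.pos.le (by linarith) hsum htransform
  have hrest : Integrable
      (fun w => L ^ (-r) * (1 + |∑ n ∈ Finset.range k, d n w| ^ (2 * r))) P :=
    ((integrable_const 1).add hpow).const_mul _
  calc ∫ w, |∑ n ∈ Finset.range k, θ n * d n w| ^ (2 * r) ∂P
      ≤ ∫ w, (burkholderFun r L (∑ n ∈ Finset.range k, d n w) (∑ n ∈ Finset.range k, θ n * d n w) +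
          L ^ (-r) * (1 + |∑ n ∈ Finset.range k, d n w| ^ (2 * r))) ∂P :=
        integral_mono (integrable_abs_rpow (by linarith) htransform) (hU.add hrest)
          fun w => hL.abs_rpow_le_burkholderFun_add (by linarith) _ _
    _ = ∫ w, burkholderFun r L (∑ n ∈ Finset.range k, d n w)
            (∑ n ∈ Finset.range k, θ n * d n w) ∂P +
          L ^ (-r) * (1 + ∫ w, |∑ n ∈ Finset.range k, d n w| ^ (2 * r) ∂P) := by
        rw [integral_add hU hrest, integral_const_mul, integral_add (integrable_const 1) hpow]
        simp
    _ ≤ _ := by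
        rw [mul_add, mul_one, ← add_assoc]
        grw [hd.integral_burkholderFun_le hL hr hθ]

end IsLpMDS

theorem le_of_forall_mul_le_add_mul {a b K : ℝ} (h : ∀ s > 0, s * a ≤ K + s * b) : a ≤ b := by
  by_contra! hba
  have hK : 0 ≤ |K| := abs_nonneg K
  have hlarge := h ((|K| + 1) / (a - b)) (div_pos (by linarith) (sub_pos.2 hba))
  have hcancel : (|K| + 1) / (a - b) * (a - b) = |K| + 1 :=
    div_mul_cancel₀ _ (sub_pos.2 hba).ne'
  linarith [le_abs_self K, mul_sub ((|K| + 1) / (a - b)) a b]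

/-- **Burkholder's inequality**. -/
theorem exists_integral_transform_le {p : ℝ} (hp : 1 < p) : ∃ C : ℝ, 0 < C ∧
    ∀ {Ω : Type*} {mΩ : MeasurableSpace Ω} (P : Measure Ω) [IsProbabilityMeasure P]
      {m : ℕ → MeasurableSpace Ω} {k : ℕ} {d : ℕ → Ω → ℝ} (_ : IsLpMDS P (ENNReal.ofReal p) m k d)
      {θ : ℕ → ℝ} (_ : ∀ n, |θ n| ≤ 1),
      ∫ w, |∑ n ∈ Finset.range k, θ n * d n w| ^ p ∂P ≤
        C * ∫ w, |∑ n ∈ Finset.range k, d n w| ^ p ∂P := by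
  obtain ⟨r, rfl⟩ : ∃ r, p = 2 * r := ⟨p / 2, by ring⟩
  have hr : 1 / 2 < r := by linarith
  obtain ⟨L, hL⟩ := exists_isAdmissibleScale hr
  refine ⟨L ^ (-r), Real.rpow_pos_of_pos hL.pos _, fun P _ m k d hd θ hθ => ?_⟩
  refine le_of_forall_mul_le_add_mul (K := 2 + L ^ (-r)) fun s hs => ?_
  have hpow : ∀ u, |s ^ (2 * r)⁻¹ * u| ^ (2 * r) = s * |u| ^ (2 * r) := fun u => by
    rw [abs_mul, abs_of_nonneg (Real.rpow_nonneg hs.le _),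
      Real.mul_rpow (Real.rpow_nonneg hs.le _) (abs_nonneg u),
      Real.rpow_inv_rpow hs.le (by linarith)]
  have hscaled := (hd.const_mul fun _ => s ^ (2 * r)⁻¹).integral_abs_rpow_le_add hL hr hθ
  simp only [mul_left_comm (θ _), ← Finset.mul_sum, hpow, integral_const_mul] at hscaled
  linarith

end Martingale

/-! ### Unconditional families and Schauder decompositions -/

section Decompositions

variable {E : Type*} [NormedAddCommGroup E] [NormedSpace ℝ E]

/-- `(e i)_{i ∈ S}` is unconditional with constant `C`, tested on finite sums. No order of `S` is
involved, so that one constant serves all enumerations of `S`. -/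
def UnconditionalOn {ι : Type*} (S : Set ι) (e : ι → E) (C : ℝ) : Prop :=
  ∀ s : Finset ι, (s : Set ι) ⊆ S → ∀ a b : ι → ℝ, (∀ i ∈ s, |a i| ≤ |b i|) →
    ‖∑ i ∈ s, a i • e i‖ ≤ C * ‖∑ i ∈ s, b i • e i‖

namespace UnconditionalOn

variable {ι β : Type*} {S : Set ι} {e : ι → E} {C : ℝ}

theorem blocks (h : UnconditionalOn S e C) {B : Set β} {A : β → Set ι} {y : β → E}
    (hAS : ∀ b ∈ B, A b ⊆ S) (hA : B.PairwiseDisjoint A)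
    (hy : ∀ b ∈ B, y b ∈ Submodule.span ℝ (e '' A b)) : UnconditionalOn B y C := by
  classical
  intro t htB a b hab
  choose! c hc hcy using fun i hi => (Finsupp.mem_span_image_iff_linearCombination ℝ).1 (hy i hi)
  have hcA : ∀ i ∈ B, ∀ j, c i j ≠ 0 → j ∈ A i := fun i hi j hj =>
    (Finsupp.mem_supported ℝ (c i)).1 (hc i hi) (Finsupp.mem_support_iff.2 hj)
  set u := t.biUnion fun i => (c i).support
  have hsum : ∀ a : β → ℝ, ∑ i ∈ t, a i • y i = ∑ j ∈ u, (∑ i ∈ t, a i * c i j) • e j := by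
    intro a
    simp_rw [Finset.sum_smul, Finset.sum_comm (s := u), mul_smul, ← Finset.smul_sum]
    refine Finset.sum_congr rfl fun i hi => ?_
    rw [← hcy i (htB hi), Finsupp.linearCombination_apply,
      Finsupp.sum_of_support_subset _
        (Finset.subset_biUnion_of_mem (fun i => (c i).support) hi) _ (by simp)]
  have hsupport : ∀ j ∈ u, ∃ i ∈ t, c i j ≠ 0 := fun j hj => by simpa [u] using hj
  rw [hsum a, hsum b]
  refine h u (fun j hj => ?_) _ _ fun j hj => ?_
  · obtain ⟨i, hi, hij⟩ := hsupport j hj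
    exact hAS i (htB hi) (hcA i (htB hi) j hij)
  · obtain ⟨i, hi, hij⟩ := hsupport j hj
    have hother : ∀ i' ∈ t, i' ≠ i → c i' j = 0 := fun i' hi' hne => by
      by_contra hi'j
      exact Set.disjoint_left.1 (hA (htB hi') (htB hi) hne) (hcA i' (htB hi') j hi'j)
        (hcA i (htB hi) j hij)
    have hsingle : ∀ a : β → ℝ, ∑ i' ∈ t, a i' * c i' j = a i * c i j := fun a =>
      Finset.sum_eq_single_of_mem i hi fun i' hi' hne => by rw [hother i' hi' hne, mul_zero]
    rw [hsingle a, hsingle b, abs_mul, abs_mul]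
    exact mul_le_mul_of_nonneg_right (hab i hi) (abs_nonneg _)

theorem of_surjOn {S' : Set β} {s : β → ι} (h : UnconditionalOn S' (fun j => e (s j)) C)
    (hs : Set.SurjOn s S' S) : UnconditionalOn S e C := by
  refine h.blocks (A := fun i => {j ∈ S' | s j = i}) (fun i _ j hj => hj.1)
    (fun i _ i' _ hne => Set.disjoint_left.2 fun j hj hj' => hne (hj.2.symm.trans hj'.2))
    fun i hi => ?_
  obtain ⟨j, hj, rfl⟩ := hs hi
  exact Submodule.subset_span ⟨j, ⟨hj, rfl⟩, rfl⟩

theorem comp_injOn (h : UnconditionalOn S e C) {S' : Set β} {s : β → ι}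
    (hs : Set.MapsTo s S' S) (hinj : Set.InjOn s S') :
    UnconditionalOn S' (fun j => e (s j)) C :=
  h.blocks (A := fun j => {s j}) (fun j hj => Set.singleton_subset_iff.2 (hs hj))
    (fun _ hj _ hj' hne => Set.disjoint_singleton.2 (hinj.ne hj hj' hne))
    fun j _ => by simp

theorem norm_sum_le_of_subset (h : UnconditionalOn S e C) {s t : Finset ι} (hst : s ⊆ t)
    (htS : (t : Set ι) ⊆ S) : ‖∑ i ∈ s, e i‖ ≤ C * ‖∑ i ∈ t, e i‖ := by
  classical
  have hindicator := h t htS (fun i => if i ∈ s then 1 else 0) (fun _ => 1)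
    fun i _ => by split_ifs <;> simp
  simpa [ite_smul, Finset.sum_ite_mem, Finset.inter_eq_right.2 hst] using hindicator

end UnconditionalOn

section Expansions

variable {G : ℕ → Submodule ℝ E} {C : ℝ} {x z : E} {y w : ℕ → E}

/-- `x = ∑ y n` is an expansion of `x` along the subspaces `G n`. -/
structure IsExpansion (G : ℕ → Submodule ℝ E) (y : ℕ → E) (x : E) : Prop where
  mem : ∀ n, y n ∈ G n
  tendsto : Tendsto (fun k => ∑ n ∈ Finset.range k, y n) atTop (𝓝 x)

/-- The partial sum projections along the subspaces `G n` are bounded by `C`. -/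
def HasPartialSumConst (G : ℕ → Submodule ℝ E) (C : ℝ) : Prop :=
  ∀ y : ℕ → E, (∀ n, y n ∈ G n) → ∀ k m, k ≤ m →
    ‖∑ n ∈ Finset.range k, y n‖ ≤ C * ‖∑ n ∈ Finset.range m, y n‖

theorem IsExpansion.sub (hy : IsExpansion G y x) (hw : IsExpansion G w z) :
    IsExpansion G (y - w) (x - z) where
  mem n := (G n).sub_mem (hy.mem n) (hw.mem n)
  tendsto := by simpa using hy.tendsto.sub hw.tendsto

theorem exists_isExpansion_of_mem_iSup (hx : x ∈ ⨆ n, G n) : ∃ y, IsExpansion G y x := by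
  obtain ⟨f, hf, rfl⟩ := (Submodule.mem_iSup_iff_exists_finsupp _ _).1 hx
  exact ⟨f, hf, (hasSum_sum_of_ne_finset_zero fun n hn => by simpa using hn).tendsto_sum_nat⟩

namespace HasPartialSumConst

theorem norm_sum_le (hC : HasPartialSumConst G C) (hy : IsExpansion G y x) (k : ℕ) :
    ‖∑ n ∈ Finset.range k, y n‖ ≤ C * ‖x‖ :=
  ge_of_tendsto (hy.tendsto.norm.const_mul C)
    ((eventually_ge_atTop k).mono fun m hm => hC y hy.mem k m hm)

theorem isExpansion_unique (hC : HasPartialSumConst G C) (hy : IsExpansion G y x)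
    (hw : IsExpansion G w x) : y = w := by
  have hzero : ∀ k, ∑ n ∈ Finset.range k, (y - w) n = 0 := fun k =>
    norm_le_zero_iff.1 (by simpa using hC.norm_sum_le (hy.sub hw) k)
  funext n
  have hn := hzero (n + 1)
  rw [Finset.sum_range_succ, hzero n, zero_add] at hn
  exact sub_eq_zero.1 hn

theorem exists_isExpansion_of_tendsto [CompleteSpace E] (hC : HasPartialSumConst G C)
    (hG : ∀ n, IsClosed (G n : Set E)) {u : ℕ → E} {y : ℕ → ℕ → E}
    (hy : ∀ j, IsExpansion G (y j) (u j)) (hu : Tendsto u atTop (𝓝 x)) :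
    ∃ w, IsExpansion G w x := by
  have hbound : ∀ i j k, dist (∑ n ∈ Finset.range k, y i n) (∑ n ∈ Finset.range k, y j n) ≤
      C * dist (u i) (u j) := fun i j k => by
    rw [dist_eq_norm, dist_eq_norm, ← Finset.sum_sub_distrib]
    exact hC.norm_sum_le ((hy i).sub (hy j)) k
  have hunif : UniformCauchySeqOn (fun j k => ∑ n ∈ Finset.range k, y j n) atTop Set.univ := by
    have hcauchy := (cauchySeq_iff_tendsto_dist_atTop_0.1 hu.cauchySeq).const_mul C
    rw [mul_zero] at hcauchy
    intro v hv
    obtain ⟨ε, hε, hεv⟩ := Metric.mem_uniformity_dist.1 hv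
    rw [prod_atTop_atTop_eq]
    filter_upwards [hcauchy.eventually_lt_const hε] with ij hij k _
    exact hεv ((hbound ij.1 ij.2 k).trans_lt hij)
  choose l hl using fun k => cauchySeq_tendsto_of_complete (hunif.cauchySeq (Set.mem_univ k))
  have hw : ∀ n, Tendsto (fun j => y j n) atTop (𝓝 (l (n + 1) - l n)) := fun n => by
    simpa [Finset.sum_range_succ] using (hl (n + 1)).sub (hl n)
  have hlim := tendstoUniformlyOn_univ.1 (hunif.tendstoUniformlyOn_of_tendsto fun k _ =>
    tendsto_finsetSum (Finset.range k) fun n _ => hw n)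
  exact ⟨_, fun n => (hG n).mem_of_tendsto (hw n) (Eventually.of_forall fun j => (hy j).mem n),
    hlim.tendsto_of_eventually_tendsto (Eventually.of_forall fun j => (hy j).tendsto) hu⟩

theorem exists_isExpansion [CompleteSpace E] (hC : HasPartialSumConst G C)
    (hG : ∀ n, IsClosed (G n : Set E)) (hx : x ∈ (⨆ n, G n).topologicalClosure) :
    ∃ y, IsExpansion G y x := by
  obtain ⟨u, hu, hux⟩ := mem_closure_iff_seq_limit.1 hx
  choose y hy using fun j => exists_isExpansion_of_mem_iSup (hu j)
  exact hC.exists_isExpansion_of_tendsto hG hy hux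

end HasPartialSumConst

end Expansions

theorem mem_iSup_prop_iff {q : Prop} {F : Submodule ℝ E} {x : E} :
    x ∈ ⨆ (_ : q), F ↔ (q → x ∈ F) ∧ (¬ q → x = 0) := by
  by_cases hq : q <;> simp [hq]

variable {N : ℕ∞} {C : ℝ} {F : ℕ → Submodule ℝ E} {e : ℕ → E}

theorem HasPartialSumConst.isSchauderDecomposition [CompleteSpace E]
    (hC : HasPartialSumConst (fun n => ⨆ (_ : (n : ℕ∞) < N), F n) C)
    (hF : ∀ n : ℕ, (n : ℕ∞) < N → IsClosed (F n : Set E)) :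
    IsSchauderDecomposition N (⨆ (n : ℕ) (_ : (n : ℕ∞) < N), F n).topologicalClosure F := by
  refine ⟨fun n hn => ⟨(le_iSup₂ (f := fun (n : ℕ) (_ : (n : ℕ∞) < N) => F n) n hn).trans
    (Submodule.le_topologicalClosure _), hF n hn⟩, fun x hx => ?_⟩
  have hclosed : ∀ n : ℕ, IsClosed ((⨆ (_ : (n : ℕ∞) < N), F n : Submodule ℝ E) : Set E) := by
    intro n
    by_cases hn : (n : ℕ∞) < N
    · simpa [hn] using hF n hn
    · simp [hn]
  obtain ⟨y, hy⟩ := hC.exists_isExpansion hclosed hx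
  refine ⟨y, ⟨fun n => (mem_iSup_prop_iff.1 (hy.mem n)).1,
    fun n hn => (mem_iSup_prop_iff.1 (hy.mem n)).2 hn.not_gt, hy.tendsto⟩, ?_⟩
  rintro w ⟨hw, hw0, hwx⟩
  exact hC.isExpansion_unique
    ⟨fun n => mem_iSup_prop_iff.2 ⟨hw n, fun hn => hw0 n (not_lt.1 hn)⟩, hwx⟩ hy

theorem hasPartialSumConst_of_unconditionalOn
    (h : ∀ y : ℕ → E, (∀ n : ℕ, (n : ℕ∞) < N → y n ∈ F n) →
      UnconditionalOn {n : ℕ | (n : ℕ∞) < N} y C) :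
    HasPartialSumConst (fun n => ⨆ (_ : (n : ℕ∞) < N), F n) C := by
  classical
  intro y hy k m hkm
  have hfilter : ∀ l, ∑ n ∈ (Finset.range l).filter (fun n : ℕ => (n : ℕ∞) < N), y n =
      ∑ n ∈ Finset.range l, y n := fun l =>
    Finset.sum_filter_of_ne fun n _ hne => by
      by_contra hn
      exact hne ((mem_iSup_prop_iff.1 (hy n)).2 hn)
  rw [← hfilter k, ← hfilter m]
  refine (h y fun n => (mem_iSup_prop_iff.1 (hy n)).1).norm_sum_le_of_subset ?_ fun n hn => ?_
  · exact Finset.filter_subset_filter _ (Finset.range_mono hkm)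
  · exact (Finset.mem_filter.1 hn).2

theorem topologicalClosure_iSup_span_singleton (N : ℕ∞) (e : ℕ → E) :
    (⨆ (n : ℕ) (_ : (n : ℕ∞) < N), ℝ ∙ e n).topologicalClosure = closedSpan N e := by
  rw [closedSpan, Submodule.span_eq_iSup_of_singleton_spans, iSup_image]
  rfl

theorem IsSchauderDecomposition.isSchauderBasis {Y : Submodule ℝ E}
    (h : IsSchauderDecomposition N Y fun n => ℝ ∙ e n)
    (hne : ∀ n : ℕ, (n : ℕ∞) < N → e n ≠ 0) : IsSchauderBasis N Y e := by
  refine ⟨fun n hn => (h.1 n hn).1 (Submodule.mem_span_singleton_self _), fun x hx => ?_⟩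
  obtain ⟨y, ⟨hy, hy0, hyx⟩, huniq⟩ := h.2 x hx
  have hcoeff : ∀ n : ℕ, ∃ c : ℝ, c • e n = y n ∧ (N ≤ n → c = 0) := fun n => by
    rcases lt_or_ge (n : ℕ∞) N with hn | hn
    · obtain ⟨c, hc⟩ := Submodule.mem_span_singleton.1 (hy n hn)
      exact ⟨c, hc, fun h => absurd hn h.not_gt⟩
    · exact ⟨0, by simp [hy0 n hn], fun _ => rfl⟩
  choose c hc hc0 using hcoeff
  refine ⟨c, ⟨hc0, by simpa only [hc] using hyx⟩, ?_⟩
  rintro d ⟨hd0, hdx⟩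
  have hdy := huniq (fun n => d n • e n) ⟨fun n _ => Submodule.smul_mem _ _
    (Submodule.mem_span_singleton_self _), fun n hn => by simp [hd0 n hn], hdx⟩
  funext n
  rcases lt_or_ge (n : ℕ∞) N with hn | hn
  · exact smul_left_injective ℝ (hne n hn) ((congrFun hdy n).trans (hc n).symm)
  · rw [hd0 n hn, hc0 n hn]

namespace UnconditionalOn

theorem isUnconditionalBasis [CompleteSpace E] (h : UnconditionalOn {n : ℕ | (n : ℕ∞) < N} e C)
    (hne : ∀ n : ℕ, (n : ℕ∞) < N → e n ≠ 0) : IsUnconditionalBasis N (closedSpan N e) e := by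
  have hspan : ∀ y : ℕ → E, (∀ n : ℕ, (n : ℕ∞) < N → y n ∈ ℝ ∙ e n) →
      UnconditionalOn {n : ℕ | (n : ℕ∞) < N} y C := fun y hy =>
    h.blocks (A := fun n => {n}) (fun n hn => Set.singleton_subset_iff.2 hn)
      (fun _ _ _ _ hne => Set.disjoint_singleton.2 hne) fun n hn => by simpa using hy n hn
  have hdec := (hasPartialSumConst_of_unconditionalOn hspan).isSchauderDecomposition
    fun n _ => Submodule.closed_of_finiteDimensional _
  rw [topologicalClosure_iSup_span_singleton] at hdec
  refine ⟨hdec.isSchauderBasis hne, max 1 C, le_max_left _ _, fun k hk a b hab => ?_⟩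
  grw [h (Finset.range k) (fun n hn => lt_of_lt_of_le
    (Nat.cast_lt.2 (Finset.mem_range.1 hn)) hk) a b fun n hn => hab n (Finset.mem_range.1 hn)]
  gcongr
  exact le_max_right _ _

theorem isUnconditionalBasis_of_enumerates [CompleteSpace E] {ι : Type*} {S : Set ι} {e : ι → E}
    {s : ℕ → ι} (h : UnconditionalOn S e C) (hs : Enumerates N s S) (hne : ∀ i ∈ S, e i ≠ 0) :
    IsUnconditionalBasis N (closedSpan N fun n => e (s n)) fun n => e (s n) :=
  (h.comp_injOn hs.mapsTo hs.injOn).isUnconditionalBasis fun _ hn => hne _ (hs.mapsTo hn)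

theorem isUnconditionalFDD [CompleteSpace E] {ι β : Type*} {S : Set ι} {e : ι → E} {B : Set β}
    {ν : ℕ → β} {σ : ι → β} {F : β → Submodule ℝ E} (h : UnconditionalOn S e C)
    (hν : Enumerates N ν B) (hσ : Set.MapsTo σ S B)
    (hF : ∀ b ∈ B, F b = Submodule.span ℝ (e '' {i ∈ S | σ i = b}))
    (hfin : ∀ b ∈ B, FiniteDimensional ℝ (F b)) :
    IsUnconditionalFDD N (Submodule.span ℝ (e '' S)).topologicalClosure fun n => F (ν n) := by
  have hblocks : ∀ y : ℕ → E, (∀ n : ℕ, (n : ℕ∞) < N → y n ∈ F (ν n)) →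
      UnconditionalOn {n : ℕ | (n : ℕ∞) < N} y C := fun y hy =>
    h.blocks (A := fun n => {i ∈ S | σ i = ν n}) (fun _ _ _ hi => hi.1)
      (fun _ hn _ hm hne => Set.disjoint_left.2 fun _ hi hi' =>
        hne (hν.injOn hn hm (hi.2.symm.trans hi'.2)))
      fun n hn => hF _ (hν.mapsTo hn) ▸ hy n hn
  have hspan : ⨆ (n : ℕ) (_ : (n : ℕ∞) < N), F (ν n) = Submodule.span ℝ (e '' S) := by
    refine le_antisymm (iSup₂_le fun n hn => ?_) (Submodule.span_le.2 ?_)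
    · rw [hF _ (hν.mapsTo hn)]
      exact Submodule.span_mono (Set.image_mono fun i hi => hi.1)
    · rintro _ ⟨i, hi, rfl⟩
      obtain ⟨n, hn, hni⟩ := hν.surjOn (hσ hi)
      refine Submodule.mem_iSup_of_mem n (Submodule.mem_iSup_of_mem hn ?_)
      rw [hF _ (hν.mapsTo hn)]
      exact Submodule.subset_span ⟨i, ⟨hi, hni.symm⟩, rfl⟩
  refine ⟨?_, fun n hn => hfin _ (hν.mapsTo hn), fun x hx => ?_⟩
  · rw [← hspan]
    refine (hasPartialSumConst_of_unconditionalOn hblocks).isSchauderDecomposition fun n hn => ?_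
    have := hfin _ (hν.mapsTo hn)
    exact Submodule.closed_of_finiteDimensional _
  · exact (hblocks x fun n hn => (hx n hn).1).isUnconditionalBasis fun n hn => (hx n hn).2

end UnconditionalOn

end Decompositions

/-! ### Dyadic intervals and Haar functions -/

namespace Dyadic

variable {I J : Dyadic} {n : ℕ} {t : ℝ}

theorem left_nonneg (I : Dyadic) : 0 ≤ I.left := by
  unfold left
  positivity

theorem right_le_one (I : Dyadic) : I.right ≤ 1 := by
  unfold right
  rw [div_le_one (by positivity)]
  exact_mod_cast I.idx_lt

theorem right_sub_left (I : Dyadic) : I.right - I.left = (1 / 2) ^ I.level := by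
  unfold left right
  rw [← sub_div, add_sub_cancel_left, one_div_pow]

theorem measurableSet_toSet (I : Dyadic) : MeasurableSet I.toSet := measurableSet_Ico

theorem toSet_subset (I : Dyadic) : I.toSet ⊆ Set.Icc 0 1 :=
  (Set.Ico_subset_Ico I.left_nonneg I.right_le_one).trans Set.Ico_subset_Icc_self

theorem mem_toSet_iff : t ∈ I.toSet ↔ ⌊t * 2 ^ I.level⌋ = I.idx := by
  rw [Int.floor_eq_iff, toSet, Set.mem_Ico, left, right, div_le_iff₀ (by positivity),
    lt_div_iff₀ (by positivity), Int.cast_natCast]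

theorem disjoint_of_level_eq (h : I.level = J.level) (hne : I ≠ J) :
    Disjoint I.toSet J.toSet := by
  refine Set.disjoint_left.2 fun t htI htJ => hne (Dyadic.ext h ?_)
  rw [mem_toSet_iff] at htI htJ
  rw [h] at htI
  exact_mod_cast htI.symm.trans htJ

theorem subset_or_disjoint (h : I.level ≤ J.level) :
    J.toSet ⊆ I.toSet ∨ Disjoint I.toSet J.toSet := by
  obtain ⟨k, hk⟩ := Nat.exists_eq_add_of_le h
  have hfloor : ∀ t ∈ J.toSet, ⌊t * 2 ^ I.level⌋ = (J.idx : ℤ) / (2 ^ k : ℕ) := fun t ht => by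
    rw [← mem_toSet_iff.1 ht, ← Int.floor_div_natCast, hk, pow_add]
    push_cast
    congr 1
    field_simp
  by_cases hidx : (I.idx : ℤ) = (J.idx : ℤ) / (2 ^ k : ℕ)
  · exact Or.inl fun t ht => mem_toSet_iff.2 ((hfloor t ht).trans hidx.symm)
  · exact Or.inr (Set.disjoint_left.2 fun t htI htJ =>
      hidx ((mem_toSet_iff.1 htI).symm.trans (hfloor t htJ)))

theorem plus_left (I : Dyadic) : I.plus.left = I.left := by
  simp only [plus, left, pow_succ]
  push_cast
  field_simp

theorem plus_right (I : Dyadic) : I.plus.right = I.minus.left := by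
  simp [plus, minus, left, right]

theorem minus_right (I : Dyadic) : I.minus.right = I.right := by
  simp only [minus, right, pow_succ]
  push_cast
  field_simp
  ring

theorem plus_union_minus (I : Dyadic) : I.plus.toSet ∪ I.minus.toSet = I.toSet := by
  unfold toSet
  rw [← plus_left I, ← minus_right I, plus_right I]
  exact Set.Ico_union_Ico_eq_Ico (plus_right I ▸ I.plus.left_lt_right.le)
    I.minus.left_lt_right.le

theorem disjoint_plus_minus (I : Dyadic) : Disjoint I.plus.toSet I.minus.toSet :=
  disjoint_of_level_eq rfl fun h => by simpa [plus, minus] using congrArg Dyadic.idx h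

theorem unitMeasure_toSet (I : Dyadic) :
    unitMeasure I.toSet = ENNReal.ofReal ((1 / 2) ^ I.level) := by
  rw [unitMeasure, Measure.restrict_apply I.measurableSet_toSet,
    Set.inter_eq_left.2 I.toSet_subset, toSet, Real.volume_Ico, right_sub_left]

/-- The unit interval `[0,1)`. -/
def unit : Dyadic := ⟨0, 0, by norm_num⟩

theorem eq_unit (h : I.level = 0) : I = unit := by
  have hidx := I.idx_lt
  rw [h] at hidx
  exact Dyadic.ext h (by simpa [unit] using hidx)

theorem exists_eq_plus_or_minus (h : I.level = n + 1) :
    ∃ J : Dyadic, J.level = n ∧ (I = J.plus ∨ I = J.minus) := by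
  have hlt := I.idx_lt
  rw [h, pow_succ] at hlt
  refine ⟨⟨n, I.idx / 2, by omega⟩, rfl, ?_⟩
  rcases Nat.even_or_odd' I.idx with ⟨m, hm | hm⟩
  · exact Or.inl (Dyadic.ext h (by simp only [plus]; omega))
  · exact Or.inr (Dyadic.ext h (by simp only [minus]; omega))

theorem finite_setOf_level_lt (n : ℕ) : {I : Dyadic | I.level < n}.Finite := by
  refine Set.Finite.of_injOn (f := fun I => (I.level, I.idx)) (t := Set.Iio n ×ˢ Set.Iio (2 ^ n))
    (fun I hI => ⟨hI, I.idx_lt.trans (Nat.pow_lt_pow_right one_lt_two hI)⟩) (fun I _ J _ h => ?_)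
    ((Set.finite_Iio n).prod (Set.finite_Iio _))
  exact Dyadic.ext (congrArg Prod.fst h) (congrArg Prod.snd h)

/-- The Haar function `h_I` as a function on the line rather than a class in `L_p`. -/
def haarFun (I : Dyadic) (t : ℝ) : ℝ :=
  I.plus.toSet.indicator (fun _ => 1) t - I.minus.toSet.indicator (fun _ => 1) t

theorem haarFun_of_notMem (h : t ∉ I.toSet) : I.haarFun t = 0 := by
  rw [← plus_union_minus, Set.mem_union, not_or] at h
  simp [haarFun, h.1, h.2]

theorem exists_indicator_eq_on (h : I.level ≤ J.level) :
    ∃ c : ℝ, ∀ t ∈ J.toSet, I.toSet.indicator (fun _ => (1 : ℝ)) t = c := by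
  rcases subset_or_disjoint h with h | h
  · exact ⟨1, fun t ht => Set.indicator_of_mem (h ht) _⟩
  · exact ⟨0, fun t ht => Set.indicator_of_notMem (Set.disjoint_right.1 h ht) _⟩

theorem exists_haarFun_eq_on (h : I.level < J.level) : ∃ c, ∀ t ∈ J.toSet, I.haarFun t = c := by
  obtain ⟨c, hc⟩ := exists_indicator_eq_on (I := I.plus) h
  obtain ⟨d, hd⟩ := exists_indicator_eq_on (I := I.minus) h
  exact ⟨c - d, fun t ht => by rw [haarFun, hc t ht, hd t ht]⟩

theorem LexLT.exists_haarFun_eq_on (h : I.LexLT J) : ∃ c, ∀ t ∈ J.toSet, I.haarFun t = c := by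
  rcases h with h | ⟨h, hlt⟩
  · exact Dyadic.exists_haarFun_eq_on h
  · have hne : I ≠ J := fun hIJ => hlt.ne (congrArg left hIJ)
    exact ⟨0, fun t ht => haarFun_of_notMem
      (Set.disjoint_right.1 (disjoint_of_level_eq h hne) ht)⟩

variable {p : ℝ≥0∞}

theorem coeFn_char (I : Dyadic) :
    (I.char p : ℝ → ℝ) =ᵐ[unitMeasure] I.toSet.indicator fun _ => 1 :=
  indicatorConstLp_coeFn

theorem coeFn_haar (I : Dyadic) : (I.haar p : ℝ → ℝ) =ᵐ[unitMeasure] I.haarFun :=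
  (Lp.coeFn_sub _ _).trans (I.plus.coeFn_char.sub I.minus.coeFn_char)

theorem integral_char (I : Dyadic) : ∫ t, I.char p t ∂unitMeasure = (1 / 2) ^ I.level := by
  rw [integral_congr_ae I.coeFn_char, integral_indicator_const _ I.measurableSet_toSet,
    Measure.real, unitMeasure_toSet, ENNReal.toReal_ofReal (by positivity), smul_eq_mul, mul_one]

theorem haar_mem_meanZero [Fact (1 ≤ p)] (I : Dyadic) : I.haar p ∈ meanZero p := by
  change ∫ t, I.haar p t ∂unitMeasure = 0
  rw [haar, integral_congr_ae (Lp.coeFn_sub _ _)]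
  simp only [Pi.sub_apply]
  rw [integral_sub ((Lp.memLp _).integrable Fact.out) ((Lp.memLp _).integrable Fact.out),
    integral_char, integral_char]
  simp [plus, minus]

theorem haar_ne_zero (I : Dyadic) : I.haar p ≠ 0 := by
  intro h
  have hplus : ∀ᵐ t ∂unitMeasure, t ∉ I.plus.toSet := by
    filter_upwards [I.coeFn_haar (p := p), Lp.coeFn_zero ℝ p unitMeasure] with t hhaar hzero ht
    rw [h, hzero, haarFun, Set.indicator_of_mem ht,
      Set.indicator_of_notMem (Set.disjoint_left.1 I.disjoint_plus_minus ht)] at hhaar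
    simp at hhaar
  have hmeasure := measure_eq_zero_iff_ae_notMem.2 hplus
  rw [unitMeasure_toSet, ENNReal.ofReal_eq_zero] at hmeasure
  exact hmeasure.not_gt (by positivity)

theorem char_eq_plus_add_minus (I : Dyadic) : I.char p = I.plus.char p + I.minus.char p := by
  apply Lp.ext
  filter_upwards [Lp.coeFn_add (I.plus.char p) (I.minus.char p), I.plus.coeFn_char (p := p),
    I.minus.coeFn_char (p := p), I.coeFn_char (p := p)] with t hadd hplus hminus hI
  rw [hadd, Pi.add_apply, hplus, hminus, hI, ← plus_union_minus,
    Set.indicator_union_of_disjoint I.disjoint_plus_minus]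

theorem char_plus_eq (I : Dyadic) : I.plus.char p = (1 / 2 : ℝ) • (I.char p + I.haar p) := by
  rw [char_eq_plus_add_minus I, haar]
  module

theorem char_minus_eq (I : Dyadic) : I.minus.char p = (1 / 2 : ℝ) • (I.char p - I.haar p) := by
  rw [char_eq_plus_add_minus I, haar]
  module

variable (p) in
/-- The span of `(χ_I)_{I ∈ 𝒟^n}`: the functions constant on the dyadic intervals of level `n`. -/
def charSpan (n : ℕ) : Submodule ℝ (LpI p) := Submodule.span ℝ (char p '' {I | I.level = n})

theorem char_mem_charSpan (h : I.level ≤ n) : I.char p ∈ charSpan p n := by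
  obtain ⟨k, hk⟩ := Nat.exists_eq_add_of_le h
  induction k generalizing I with
  | zero => exact Submodule.subset_span ⟨I, hk.symm, rfl⟩
  | succ k ih =>
    rw [char_eq_plus_add_minus]
    exact add_mem (ih (by simp only [plus]; omega) (by simp only [plus]; omega))
      (ih (by simp only [minus]; omega) (by simp only [minus]; omega))

theorem haar_mem_charSpan (h : I.level < n) : I.haar p ∈ charSpan p n :=
  sub_mem (char_mem_charSpan h) (char_mem_charSpan h)

theorem charSpan_le (n : ℕ) :
    charSpan p n ≤ (ℝ ∙ unit.char p) ⊔ Submodule.span ℝ (haar p '' {I | I.level < n}) := by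
  induction n with
  | zero =>
    refine Submodule.span_le.2 ?_
    rintro _ ⟨I, hI, rfl⟩
    rw [eq_unit hI]
    exact Submodule.mem_sup_left (Submodule.mem_span_singleton_self _)
  | succ n ih =>
    refine Submodule.span_le.2 ?_
    rintro _ ⟨I, hI, rfl⟩
    obtain ⟨J, rfl, hIJ⟩ := exists_eq_plus_or_minus hI
    have hmono : Submodule.span ℝ (haar p '' {I | I.level < J.level}) ≤
        Submodule.span ℝ (haar p '' {I | I.level < J.level + 1}) :=
      Submodule.span_mono (Set.image_mono fun I hI => lt_trans hI (lt_add_one J.level))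
    have hchar := sup_le_sup_left hmono (ℝ ∙ unit.char p) (ih (char_mem_charSpan le_rfl))
    have hhaar : J.haar p ∈
        (ℝ ∙ unit.char p) ⊔ Submodule.span ℝ (haar p '' {I | I.level < J.level + 1}) :=
      Submodule.mem_sup_right (Submodule.subset_span ⟨J, lt_add_one J.level, rfl⟩)
    rcases hIJ with rfl | rfl
    · exact char_plus_eq (p := p) J ▸ Submodule.smul_mem _ _ (add_mem hchar hhaar)
    · exact char_minus_eq (p := p) J ▸ Submodule.smul_mem _ _ (sub_mem hchar hhaar)

end Dyadic

theorem dyadicMeanZero_eq_span {p : ℝ≥0∞} [Fact (1 ≤ p)] (n : ℕ) :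
    dyadicMeanZero p n = Submodule.span ℝ (Dyadic.haar p '' {I | I.level < n}) := by
  have hspan : Submodule.span ℝ (Dyadic.haar p '' {I | I.level < n}) ≤ meanZero p := by
    refine Submodule.span_le.2 ?_
    rintro _ ⟨I, _, rfl⟩
    exact I.haar_mem_meanZero
  refine le_antisymm ?_ (le_inf (Submodule.span_le.2 ?_) hspan)
  · rintro f ⟨hf, hf0⟩
    obtain ⟨c, hc, g, hg, rfl⟩ := Submodule.mem_sup.1 (Dyadic.charSpan_le n hf)
    obtain ⟨a, rfl⟩ := Submodule.mem_span_singleton.1 hc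
    have hint : ∫ t, (a • Dyadic.unit.char p : LpI p) t ∂unitMeasure = 0 :=
      ((meanZero p).add_mem_iff_left (hspan hg)).1 hf0
    have ha : a = 0 := by
      rw [integral_congr_ae (Lp.coeFn_smul _ _)] at hint
      simp only [Pi.smul_apply, integral_smul, Dyadic.integral_char] at hint
      simpa [Dyadic.unit] using hint
    simpa [ha] using hg
  · rintro _ ⟨I, hI, rfl⟩
    exact Dyadic.haar_mem_charSpan hI

/-! ### Compressions -/

namespace Dyadic

variable {p : ℝ≥0∞}

/-- The affine map of the interval `I` onto `[0,1)`. -/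
def rescale (I : Dyadic) (t : ℝ) : ℝ := (t - I.left) / (I.right - I.left)

theorem measurable_rescale (I : Dyadic) : Measurable I.rescale := BRS.measurable_rescale _ _

theorem map_rescale (I : Dyadic) :
    (unitMeasure.restrict I.toSet).map I.rescale =
      ENNReal.ofReal ((1 / 2) ^ I.level) • unitMeasure := by
  have hmass : ((unitMeasure.restrict I.toSet).map I.rescale) Set.univ =
      (ENNReal.ofReal ((1 / 2) ^ I.level) • unitMeasure) Set.univ := by
    rw [Measure.map_apply I.measurable_rescale MeasurableSet.univ, Set.preimage_univ,
      Measure.restrict_apply_univ, unitMeasure_toSet, Measure.smul_apply, measure_univ, smul_eq_mul,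
      mul_one]
  exact Measure.eq_of_le_of_measure_univ_eq
    (right_sub_left I ▸ map_rescale_le I.left_lt_right) hmass

theorem ae_rescale (I : Dyadic) {P : ℝ → Prop} (h : ∀ᵐ t ∂unitMeasure, P t) :
    ∀ᵐ t ∂unitMeasure, t ∈ I.toSet → P (I.rescale t) :=
  (ae_restrict_iff' I.measurableSet_toSet).1
    ((quasiMeasurePreserving_rescale I.left_lt_right).ae h)

theorem setIntegral_rescale (I : Dyadic) {f : ℝ → ℝ} (hf : AEStronglyMeasurable f unitMeasure) :
    ∫ t in I.toSet, f (I.rescale t) ∂unitMeasure = (1 / 2) ^ I.level * ∫ t, f t ∂unitMeasure := by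
  rw [← integral_map I.measurable_rescale.aemeasurable (I.map_rescale ▸ hf.smul_measure _),
    map_rescale, integral_smul_measure, ENNReal.toReal_ofReal (by positivity), smul_eq_mul]

theorem coeFn_T (I : Dyadic) (f : LpI p) :
    (I.T p f : ℝ → ℝ) =ᵐ[unitMeasure] I.toSet.indicator fun t => f (I.rescale t) :=
  (memLp_compressFun I.left_lt_right f).coeFn_toLp

theorem integral_T (I : Dyadic) (f : LpI p) :
    ∫ t, I.T p f t ∂unitMeasure = (1 / 2) ^ I.level * ∫ t, f t ∂unitMeasure := by
  rw [integral_congr_ae (I.coeFn_T f), integral_indicator I.measurableSet_toSet,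
    setIntegral_rescale I (Lp.aestronglyMeasurable f)]

theorem T_const (I : Dyadic) (c : ℝ) : I.T p (Lp.const p unitMeasure c) = c • I.char p := by
  apply Lp.ext
  filter_upwards [I.coeFn_T (Lp.const p unitMeasure c), Lp.coeFn_smul c (I.char p),
    I.coeFn_char (p := p)] with t hT hsmul hchar
  rw [hT, hsmul, Pi.smul_apply, hchar]
  by_cases ht : t ∈ I.toSet <;> simp [ht]

theorem T_unit (f : LpI p) : unit.T p f = f := by
  apply Lp.ext
  have hmem : ∀ᵐ t ∂unitMeasure, t ∈ unit.toSet := by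
    have htoSet : unit.toSet = Set.Ico 0 1 := by simp [toSet, left, right, unit]
    rw [htoSet, unitMeasure, ← restrict_Ico_eq_restrict_Icc]
    exact ae_restrict_mem measurableSet_Ico
  filter_upwards [unit.coeFn_T f, hmem] with t hT ht
  rw [hT, Set.indicator_of_mem ht]
  simp [rescale, left, right, unit]

/-- The image of `J` under the affine map of `[0,1)` onto `I`, so that `T_I T_J = T_{comp I J}`. -/
def comp (I J : Dyadic) : Dyadic where
  level := I.level + J.level
  idx := I.idx * 2 ^ J.level + J.idx
  idx_lt := by
    have hI := Nat.mul_le_mul_right (2 ^ J.level) (Nat.succ_le_of_lt I.idx_lt)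
    rw [Nat.succ_mul, ← pow_add] at hI
    exact (Nat.add_lt_add_left J.idx_lt _).trans_le hI

theorem rescale_comp (I J : Dyadic) (t : ℝ) : (I.comp J).rescale t = J.rescale (I.rescale t) := by
  simp only [rescale, right_sub_left]
  simp only [comp, left, one_div_pow, pow_add]
  push_cast
  field_simp
  ring

theorem mem_toSet_iff_rescale {I : Dyadic} {t : ℝ} :
    t ∈ I.toSet ↔ 0 ≤ I.rescale t ∧ I.rescale t < 1 := by
  have hlt := sub_pos.2 I.left_lt_right
  rw [rescale, le_div_iff₀ hlt, zero_mul, sub_nonneg, div_lt_one hlt, sub_lt_sub_iff_right]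
  rfl

theorem mem_toSet_comp_iff {I J : Dyadic} {t : ℝ} :
    t ∈ (I.comp J).toSet ↔ t ∈ I.toSet ∧ I.rescale t ∈ J.toSet := by
  rw [mem_toSet_iff_rescale, rescale_comp, ← mem_toSet_iff_rescale, mem_toSet_iff_rescale (I := I),
    iff_and_self]
  exact fun h => ⟨J.left_nonneg.trans h.1, h.2.trans_le J.right_le_one⟩

theorem T_T (I J : Dyadic) (f : LpI p) : I.T p (J.T p f) = (I.comp J).T p f := by
  apply Lp.ext
  filter_upwards [I.coeFn_T (J.T p f), (I.comp J).coeFn_T f, I.ae_rescale (J.coeFn_T f)]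
    with t hI hIJ hJ
  rw [hI, hIJ]
  by_cases ht : t ∈ I.toSet
  · rw [Set.indicator_of_mem ht, hJ ht]
    by_cases htJ : I.rescale t ∈ J.toSet <;> simp [mem_toSet_comp_iff, ht, htJ, rescale_comp]
  · rw [Set.indicator_of_notMem ht,
      Set.indicator_of_notMem fun h => ht (mem_toSet_comp_iff.1 h).1]

theorem exists_eq_comp {I : Dyadic} {n : ℕ} (h : I.level = n + 1) :
    ∃ J : Dyadic, J.level = n ∧ (I = unit.plus.comp J ∨ I = unit.minus.comp J) := by
  have hlt := I.idx_lt
  rw [h, pow_succ] at hlt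
  by_cases hidx : I.idx < 2 ^ n
  · refine ⟨⟨n, I.idx, hidx⟩, rfl, Or.inl (Dyadic.ext ?_ ?_)⟩
    · simp only [comp, plus, unit]; omega
    · simp [comp, plus, unit]
  · refine ⟨⟨n, I.idx - 2 ^ n, by omega⟩, rfl, Or.inr (Dyadic.ext ?_ ?_)⟩
    · simp only [comp, minus, unit]; omega
    · simp only [comp, minus, unit]; omega

theorem norm_T (hp : p ≠ ∞) (I : Dyadic) (f : LpI p) :
    ‖I.T p f‖ = ((1 / 2) ^ I.level) ^ (1 / p.toReal) * ‖f‖ := by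
  have hf : AEStronglyMeasurable f ((unitMeasure.restrict I.toSet).map I.rescale) :=
    I.map_rescale ▸ (Lp.aestronglyMeasurable f).smul_measure _
  have heLpNorm : eLpNorm (fun t => f (I.rescale t)) p (unitMeasure.restrict I.toSet) =
      ENNReal.ofReal ((1 / 2) ^ I.level) ^ (1 / p).toReal * eLpNorm f p unitMeasure := by
    rw [← smul_eq_mul, ← eLpNorm_smul_measure_of_ne_top hp, ← I.map_rescale,
      eLpNorm_map_measure hf I.measurable_rescale.aemeasurable]
    rfl
  rw [Lp.norm_def, eLpNorm_congr_ae (I.coeFn_T f),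
    eLpNorm_indicator_eq_eLpNorm_restrict I.measurableSet_toSet, heLpNorm, ENNReal.toReal_mul,
    ← Lp.norm_def, ENNReal.ofReal_rpow_of_pos (by positivity),
    ENNReal.toReal_ofReal (by positivity), ENNReal.toReal_div, ENNReal.toReal_one]

variable [Fact (1 ≤ p)]

theorem continuous_T (hp : p ≠ ∞) (I : Dyadic) : Continuous (I.T p) :=
  AddMonoidHomClass.continuous_of_bound _ _ fun f => (norm_T hp I f).le

theorem T_injective (hp : p ≠ ∞) (I : Dyadic) : Function.Injective (I.T p) := by
  refine (injective_iff_map_eq_zero _).2 fun f hf => norm_eq_zero.1 ?_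
  have hnorm := norm_T hp I f
  rw [hf, norm_zero, eq_comm, mul_eq_zero] at hnorm
  exact hnorm.resolve_left (by positivity)

theorem T_mem_meanZero (I : Dyadic) {f : LpI p} (hf : f ∈ meanZero p) : I.T p f ∈ meanZero p :=
  (I.integral_T f).trans (mul_eq_zero_of_right _ hf)

end Dyadic

/-! ### Distributional embeddings -/

theorem measurable_coe {p : ℝ≥0∞} (f : LpI p) : Measurable f := (Lp.stronglyMeasurable f).measurable

theorem measurable_pi_coe {p : ℝ≥0∞} {ι : Type*} (u : ι → LpI p) : Measurable fun t i => u i t :=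
  measurable_pi_lambda _ fun i => measurable_coe (u i)

/-- The image `∑ i, L e_i • u i` of a finite family in `L_p` under a linear functional `L` on the
values. -/
def dualComb {p : ℝ≥0∞} {ι : Type*} [Fintype ι] [DecidableEq ι] (L : StrongDual ℝ (ι → ℝ))
    (u : ι → LpI p) : LpI p := ∑ i, L (Pi.single i 1) • u i

section DualComb

variable {p : ℝ≥0∞} {ι : Type*} [Fintype ι] [DecidableEq ι]

theorem coeFn_dualComb (L : StrongDual ℝ (ι → ℝ)) (u : ι → LpI p) :
    (dualComb L u : ℝ → ℝ) =ᵐ[unitMeasure] fun t => L fun i => u i t := by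
  have hsmul : ∀ᵐ t ∂unitMeasure, ∀ i, (L (Pi.single i 1) • u i : LpI p) t =
      L (Pi.single i 1) • u i t :=
    ae_all_iff.2 fun i => Lp.coeFn_smul (L (Pi.single i 1)) (u i)
  filter_upwards [hsmul, Lp.coeFn_fun_finsetSum Finset.univ fun i => L (Pi.single i 1) • u i]
    with t hsmul hsum
  rw [dualComb, hsum, pi_eq_sum_univ' fun i => u i t, map_sum]
  exact Finset.sum_congr rfl fun i _ => by rw [hsmul, map_smul, smul_eq_mul, smul_eq_mul, mul_comm]

theorem charFunDual_map_pi_coe (L : StrongDual ℝ (ι → ℝ)) (u : ι → LpI p) :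
    charFunDual (Measure.map (fun t i => u i t) unitMeasure) L =
      charFun (Measure.map (dualComb L u) unitMeasure) 1 := by
  rw [charFunDual_eq_charFun_map_one, Measure.map_map (by fun_prop) (measurable_pi_coe u)]
  congr 1
  exact Measure.map_congr (coeFn_dualComb L u).symm

theorem map_dualComb (S : LpI p →ₗ[ℝ] LpI p) (L : StrongDual ℝ (ι → ℝ)) (u : ι → LpI p) :
    S (dualComb L u) = dualComb L fun i => S (u i) := by
  simp only [dualComb, map_sum, map_smul]

end DualComb

namespace IsDistributionalEmbedding

variable {p : ℝ≥0∞} {S : LpI p →ₗ[ℝ] LpI p}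

/-- By linearity the marginals determine the joint distributions (Cramér–Wold). -/
theorem map_pi_eq (hS : IsDistributionalEmbedding S) {ι : Type*} [Finite ι] (u : ι → LpI p) :
    Measure.map (fun t i => S (u i) t) unitMeasure =
      Measure.map (fun t i => u i t) unitMeasure := by
  classical
  have := Fintype.ofFinite ι
  have hprob (v : ι → LpI p) : IsProbabilityMeasure (Measure.map (fun t i => v i t) unitMeasure) :=
    Measure.isProbabilityMeasure_map (measurable_pi_coe v).aemeasurable
  have := hprob u
  have := hprob fun i => S (u i)
  refine Measure.ext_of_charFunDual (funext fun L => ?_)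
  rw [charFunDual_map_pi_coe L fun i => S (u i), charFunDual_map_pi_coe, ← map_dualComb, hS]

theorem map_const (hS : IsDistributionalEmbedding S) (c : ℝ) :
    S (Lp.const p unitMeasure c) = Lp.const p unitMeasure c := by
  have hmem (f : LpI p) : (∀ᵐ x ∂Measure.map f unitMeasure, x ∈ ({c} : Set ℝ)) ↔
      f =ᵐ[unitMeasure] Function.const ℝ c :=
    ae_map_iff (measurable_coe f).aemeasurable (measurableSet_singleton c)
  have hconst := Lp.coeFn_const p unitMeasure c
  rw [← hmem, ← hS, hmem] at hconst
  exact Lp.ext (hconst.trans (Lp.coeFn_const p unitMeasure c).symm)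

theorem integral_eq (hS : IsDistributionalEmbedding S) (f : LpI p) :
    ∫ t, S f t ∂unitMeasure = ∫ t, f t ∂unitMeasure := by
  have hmap (g : LpI p) := integral_map (μ := unitMeasure) (measurable_coe g).aemeasurable
    (f := fun x : ℝ => x) aestronglyMeasurable_id
  rw [← hmap, ← hmap, hS]

theorem norm_eq (hS : IsDistributionalEmbedding S) (f : LpI p) : ‖S f‖ = ‖f‖ := by
  have hmap (g : LpI p) : eLpNorm g p unitMeasure = eLpNorm id p (Measure.map g unitMeasure) :=
    (eLpNorm_map_measure aestronglyMeasurable_id (measurable_coe g).aemeasurable).symm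
  rw [Lp.norm_def, Lp.norm_def, hmap, hmap, hS]

variable [Fact (1 ≤ p)]

theorem injective (hS : IsDistributionalEmbedding S) : Function.Injective S :=
  (injective_iff_map_eq_zero _).2 fun f hf => by rw [← norm_eq_zero, ← hS.norm_eq, hf, norm_zero]

theorem continuous (hS : IsDistributionalEmbedding S) : Continuous S :=
  AddMonoidHomClass.continuous_of_bound S 1 fun f => by rw [hS.norm_eq, one_mul]

theorem mem_meanZero (hS : IsDistributionalEmbedding S) {f : LpI p} (hf : f ∈ meanZero p) :
    S f ∈ meanZero p :=
  (hS.integral_eq f).trans hf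

end IsDistributionalEmbedding

namespace IsIndependentSystem

variable {p : ℝ≥0∞} {T : Ordinal.{0} → Ordinal.{0} → LpI p →ₗ[ℝ] LpI p} {α β : Ordinal.{0}}
  {ι κ : Type*}

theorem indepFun_sum (hT : IsIndependentSystem T) (hα : α < ω₁) (hlim : Order.IsSuccLimit α)
    (hβ : β < α) [Fintype κ] {b : κ → Ordinal.{0}} (hb : ∀ k, b k < α ∧ b k ≠ β) (V : κ → LpI p)
    (W : LpI p) : IndepFun (∑ k, T α (b k) (V k) : LpI p) (T α β W) unitMeasure := by
  classical
  let β' : Set.Iio α := ⟨β, hβ⟩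
  let b' : κ → Set.Iio α := fun k => ⟨b k, (hb k).1⟩
  have hne (k : κ) : b' k ≠ β' := fun h => (hb k).2 (congrArg Subtype.val h)
  let F : Set.Iio α → LpI p := fun γ => if γ = β' then W else ∑ k with b' k = γ, V k
  have hindep := ((hT α hα hlim).2 F).indepFun_finsetSum_of_notMem
    (fun γ => measurable_coe _) (s := Finset.univ.image b') (i := β')
    (by simpa only [Finset.mem_image, Finset.mem_univ, true_and, not_exists] using hne)
  have hW : T α β' (F β') = T α β W := by simp only [F, if_true, β']
  have hsum : ∑ γ ∈ Finset.univ.image b', T α γ (F γ) = ∑ k, T α (b k) (V k) := by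
    rw [← Finset.sum_fiberwise_of_maps_to (t := Finset.univ.image b')
      (fun k _ => Finset.mem_image_of_mem b' (Finset.mem_univ k))]
    refine Finset.sum_congr rfl fun γ hγ => ?_
    obtain ⟨l, _, rfl⟩ := Finset.mem_image.1 hγ
    simp only [F, if_neg (hne l), map_sum]
    exact Finset.sum_congr rfl fun k hk => by rw [← (Finset.mem_filter.1 hk).2]
  exact hindep.congr (hsum ▸ (Lp.coeFn_finsetSum _ _).symm) (hW ▸ EventuallyEq.rfl)

theorem indepFun_pi (hT : IsIndependentSystem T) (hα : α < ω₁) (hlim : Order.IsSuccLimit α)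
    (hβ : β < α) [Finite ι] [Finite κ] {b : κ → Ordinal.{0}} (hb : ∀ k, b k < α ∧ b k ≠ β)
    (U : ι → LpI p) (V : κ → LpI p) :
    IndepFun (fun t k => T α (b k) (V k) t) (fun t i => T α β (U i) t) unitMeasure := by
  classical
  have := Fintype.ofFinite ι
  have := Fintype.ofFinite κ
  set v : κ → LpI p := fun k => T α (b k) (V k)
  set u : ι → LpI p := fun i => T α β (U i)
  have hv := measurable_pi_coe v
  have hu := measurable_pi_coe u
  refine (indepFun_iff_charFunDual_prod hv.aemeasurable hu.aemeasurable).2 fun L => ?_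
  set L₁ := L.comp (.inl ℝ (κ → ℝ) (ι → ℝ))
  set L₂ := L.comp (.inr ℝ (κ → ℝ) (ι → ℝ))
  have hindep : IndepFun (dualComb L₁ v) (dualComb L₂ u) unitMeasure := by
    have h := hT.indepFun_sum hα hlim hβ hb (fun k => L₁ (Pi.single k 1) • V k) (dualComb L₂ U)
    simp only [map_dualComb, map_smul] at h
    exact h
  have hsum : (fun t => L (fun k => v k t, fun i => u i t)) =ᵐ[unitMeasure]
      fun t => dualComb L₁ v t + dualComb L₂ u t := by
    filter_upwards [coeFn_dualComb L₁ v, coeFn_dualComb L₂ u] with t h₁ h₂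
    rw [h₁, h₂]
    simp [L₁, L₂, ← map_add]
  have hmul := congrFun (hindep.charFun_map_fun_add_eq_mul (measurable_coe _).aemeasurable
    (measurable_coe _).aemeasurable) 1
  rw [charFunDual_map_pi_coe, charFunDual_map_pi_coe, charFunDual_eq_charFun_map_one,
    Measure.map_map (by fun_prop) (hv.prodMk hu)]
  exact (congrArg (charFun · 1) (Measure.map_congr hsum)).trans hmul

end IsIndependentSystem

/-! ### Functions of mean zero given another function -/

section MeanZeroGiven

variable {Ω Ω' E : Type*} [MeasurableSpace Ω] [MeasurableSpace Ω'] [MeasurableSpace E]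
  {P : Measure Ω} {F : Ω → E} {g : Ω → ℝ}

/-- The real function `g` has integral zero over every event determined by `F`. For integrable `g`
this says `𝔼(g | F) = 0`. -/
def MeanZeroGiven (P : Measure Ω) (F : Ω → E) (g : Ω → ℝ) : Prop :=
  ∀ A : Set E, MeasurableSet A → ∫ x in F ⁻¹' A, g x ∂P = 0

namespace MeanZeroGiven

theorem congr_ae {F' : Ω → E} (h : MeanZeroGiven P F g) (hF : F =ᵐ[P] F') :
    MeanZeroGiven P F' g := by
  intro A hA
  rw [← h A hA]
  exact setIntegral_congr_set (hF.symm.preimage A)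

theorem condExp_eq_zero [IsFiniteMeasure P] (h : MeanZeroGiven P F g) (hF : Measurable F)
    (hg : Integrable g P) : P[g | MeasurableSpace.comap F inferInstance] =ᵐ[P] 0 := by
  refine (ae_eq_condExp_of_forall_setIntegral_eq hF.comap_le hg
    (fun _ _ _ => integrableOn_zero) ?_ aestronglyMeasurable_zero).symm
  rintro _ ⟨A, hA, rfl⟩ _
  rw [h A hA]
  exact integral_zero _ _

theorem of_eq_const_on_support {c : E} (hFg : ∀ᵐ x ∂P, g x ≠ 0 → F x = c)
    (hg : ∫ x, g x ∂P = 0) : MeanZeroGiven P F g := by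
  intro A _
  by_cases hc : c ∈ A
  · rw [← hg, setIntegral_eq_integral_of_ae_compl_eq_zero]
    filter_upwards [hFg] with x hx hxA
    by_contra hne
    exact hxA (Set.mem_preimage.2 (hx hne ▸ hc))
  · refine setIntegral_eq_zero_of_ae_eq_zero ?_
    filter_upwards [hFg] with x hx hxA
    by_contra hne
    exact hc (hx hne ▸ hxA)

theorem map_iff {w : Ω → Ω'} (hw : Measurable w) {F : Ω' → E} (hF : Measurable F) {g : Ω' → ℝ}
    (hg : Measurable g) :
    MeanZeroGiven (P.map w) F g ↔ MeanZeroGiven P (F ∘ w) (g ∘ w) := by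
  refine forall₂_congr fun A hA => ?_
  rw [setIntegral_map (hF hA) hg.aestronglyMeasurable hw.aemeasurable]
  rfl

theorem add_of_indepFun [Add E] [MeasurableAdd₂ E] [IsProbabilityMeasure P] {u v : Ω → E}
    (h : MeanZeroGiven P u g) (hu : Measurable u) (hv : Measurable v) (hgm : Measurable g)
    (hg : Integrable g P) (hindep : IndepFun v (fun x => (u x, g x)) P) :
    MeanZeroGiven P (fun x => u x + v x) g := by
  set w : Ω → E × ℝ := fun x => (u x, g x)
  have hw : Measurable w := hu.prodMk hgm
  have hwP : MeanZeroGiven (P.map w) Prod.fst Prod.snd :=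
    (map_iff hw measurable_fst measurable_snd).2 h
  have := Measure.isProbabilityMeasure_map (μ := P) hw.aemeasurable
  have := Measure.isProbabilityMeasure_map (μ := P) hv.aemeasurable
  have hsnd : Integrable (Prod.snd ∘ Prod.snd) ((P.map v).prod (P.map w)) :=
    Integrable.comp_snd (f := Prod.snd)
      ((integrable_map_measure measurable_snd.aestronglyMeasurable hw.aemeasurable).2 hg) _
  have hsum : Measurable fun z : E × E × ℝ => z.2.1 + z.1 := by fun_prop
  refine (map_iff (hv.prodMk hw) hsum (measurable_snd.comp measurable_snd)).1 ?_
  rw [(indepFun_iff_map_prod_eq_prod_map_map hv.aemeasurable hw.aemeasurable).1 hindep]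
  intro A hA
  rw [← integral_indicator (hsum hA), integral_prod _ (hsnd.indicator (hsum hA))]
  refine integral_eq_zero_of_ae (Eventually.of_forall fun y => ?_)
  have hA' : MeasurableSet ((· + y) ⁻¹' A) := (measurable_id.add_const y) hA
  exact (integral_indicator (measurable_fst hA')).trans (hwP _ hA')

end MeanZeroGiven

end MeanZeroGiven

section LpI

variable {p : ℝ≥0∞} {ι : Type*}

theorem MeanZeroGiven.T [Countable ι] {f f' : ι → LpI p} {g : LpI p} {I : Dyadic}
    (h : MeanZeroGiven unitMeasure (fun t k => f' k t) g)
    (hf : ∀ k, ∀ᵐ t ∂unitMeasure, t ∈ I.toSet → f k t = f' k (I.rescale t)) :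
    MeanZeroGiven unitMeasure (fun t k => f k t) (I.T p g) := by
  intro A hA
  set F' : ℝ → ι → ℝ := fun t k => f' k t
  have hF' : MeasurableSet (F' ⁻¹' A) := measurable_pi_coe f' hA
  have hindicator : ((fun t k => f k t) ⁻¹' A).indicator (I.T p g) =ᵐ[unitMeasure]
      I.toSet.indicator fun t => (F' ⁻¹' A).indicator g (I.rescale t) := by
    filter_upwards [ae_all_iff.2 hf, I.coeFn_T g] with t hft hgt
    by_cases ht : t ∈ I.toSet
    · have hmem : t ∈ (fun t k => f k t) ⁻¹' A ↔ I.rescale t ∈ F' ⁻¹' A := by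
        simp only [Set.mem_preimage, F', funext fun k => hft k ht]
      by_cases htA : I.rescale t ∈ F' ⁻¹' A <;> simp [hgt, ht, htA, hmem]
    · simp [hgt, ht]
  rw [← integral_indicator (measurable_pi_coe f hA), integral_congr_ae hindicator,
    integral_indicator I.measurableSet_toSet, I.setIntegral_rescale
    ((measurable_coe g).indicator hF').aestronglyMeasurable, integral_indicator hF', h A hA,
    mul_zero]

theorem IsDistributionalEmbedding.meanZeroGiven [Finite ι] {S : LpI p →ₗ[ℝ] LpI p}
    (hS : IsDistributionalEmbedding S) {u : ι → LpI p} {g : LpI p}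
    (h : MeanZeroGiven unitMeasure (fun t k => u k t) g) :
    MeanZeroGiven unitMeasure (fun t k => S (u k) t) (S g) := by
  set w : Option ι → LpI p := fun o => o.elim g u
  have hF : Measurable fun (x : Option ι → ℝ) k => x (some k) := by fun_prop
  have hg : Measurable fun x : Option ι → ℝ => x none := by fun_prop
  refine (MeanZeroGiven.map_iff (measurable_pi_coe fun o => S (w o)) hF hg).1 ?_
  rw [hS.map_pi_eq w]
  exact (MeanZeroGiven.map_iff (measurable_pi_coe w) hF hg).2 h

theorem IsIndependentSystem.meanZeroGiven_add [Fact (1 ≤ p)] [Finite ι]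
    {T : Ordinal.{0} → Ordinal.{0} → LpI p →ₗ[ℝ] LpI p} (hT : IsIndependentSystem T)
    {α β : Ordinal.{0}} (hα : α < ω₁) (hlim : Order.IsSuccLimit α) (hβ : β < α) {u v : ι → LpI p}
    {b : ι → Ordinal.{0}} (hb : ∀ k, b k < α ∧ b k ≠ β) {g : LpI p}
    (h : MeanZeroGiven unitMeasure (fun t k => u k t) g) :
    MeanZeroGiven unitMeasure (fun t k => (T α β (u k) + T α (b k) (v k) : LpI p) t)
      (T α β g) := by
  have hsplit : Measurable fun x : Option ι → ℝ => ((fun k => x (some k)), x none) := by fun_prop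
  have hindep := (hT.indepFun_pi hα hlim hβ hb (fun o : Option ι => o.elim g u) v).comp
    measurable_id hsplit
  refine ((((hT α hα hlim).1 β hβ).meanZeroGiven h).add_of_indepFun (measurable_pi_coe _)
    (measurable_pi_coe fun k => T α (b k) (v k)) (measurable_coe _)
    ((Lp.memLp _).integrable Fact.out) hindep).congr_ae ?_
  filter_upwards [ae_all_iff.2 fun k => Lp.coeFn_add (T α β (u k)) (T α (b k) (v k))] with t ht
  exact (funext ht).symm

end LpI

/-! ### Trees -/

theorem kappa_zero : kappa 0 = 0 := Ordinal.limitRecOn_zero ..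

theorem kappa_add_one (α : Ordinal.{0}) : kappa (α + 1) = kappa α + 1 :=
  Ordinal.limitRecOn_add_one ..

theorem kappa_of_isSuccLimit {α : Ordinal.{0}} (h : Order.IsSuccLimit α) : kappa α = 0 :=
  Ordinal.limitRecOn_limit _ _ _ _ h

theorem exists_eq_add_kappa (α : Ordinal.{0}) :
    ∃ β : Ordinal.{0}, (β = 0 ∨ Order.IsSuccLimit β) ∧ α = β + (kappa α : Ordinal.{0}) := by
  induction α using Ordinal.limitRecOn with
  | zero => exact ⟨0, Or.inl rfl, by simp [kappa_zero]⟩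
  | add_one α ih =>
    obtain ⟨β, hβ, h⟩ := ih
    refine ⟨β, hβ, ?_⟩
    rw [kappa_add_one, Nat.cast_succ, ← add_assoc, ← h]
  | limit α hα _ => exact ⟨α, Or.inr hα, by simp [kappa_of_isSuccLimit hα]⟩

theorem kappaSeq_cons (e : Entry) {mu : List Entry} (h : mu ≠ []) :
    kappaSeq (e :: mu) = kappaSeq mu := by
  unfold kappaSeq
  rw [List.getLast?_cons_of_ne_nil h]

namespace InTree

variable {α β : Ordinal.{0}} {lam mu : List Entry}

theorem exists_eq_cons (h : InTree α lam) : ∃ l, lam = Entry.ord α :: l := by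
  cases h <;> exact ⟨_, rfl⟩

theorem ne_nil (h : InTree α lam) : lam ≠ [] := by
  obtain ⟨l, rfl⟩ := h.exists_eq_cons
  exact List.cons_ne_nil _ l

variable {p : ℝ≥0∞} {T : Ordinal.{0} → Ordinal.{0} → LpI p →ₗ[ℝ] LpI p}

theorem opSeq_limit (h : InTree β mu) (α : Ordinal.{0}) :
    opSeq T (Entry.ord α :: mu) = (T α β).comp (opSeq T mu) := by
  obtain ⟨l, rfl⟩ := h.exists_eq_cons
  rfl

theorem opSeq_induction (hT : IsIndependentSystem T) {Q : (LpI p →ₗ[ℝ] LpI p) → Prop}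
    (id : Q LinearMap.id) (interval : ∀ (I : Dyadic) (S), Q S → Q ((I.T p).comp S))
    (embedding : ∀ S' S : LpI p →ₗ[ℝ] LpI p, IsDistributionalEmbedding S' → Q S → Q (S'.comp S))
    (h : InTree α lam) (hα : α < ω₁) : Q (opSeq T lam) := by
  induction h with
  | head _ _ => exact id
  | branch α β I mu _ hαβ _ _ ih =>
    exact interval I _ (ih ((hαβ ▸ le_self_add : β ≤ α).trans_lt hα))
  | limit α β mu hlim _ hβ hmu ih =>
    rw [hmu.opSeq_limit]
    exact embedding _ _ ((hT α hα hlim).1 β hβ) (ih (hβ.trans hα))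

variable [Fact (1 ≤ p)]

theorem opSeq_injective (hp : p ≠ ∞) (hT : IsIndependentSystem T) (h : InTree α lam)
    (hα : α < ω₁) : Function.Injective (opSeq T lam) :=
  h.opSeq_induction hT (Q := fun S => Function.Injective S) Function.injective_id
    (fun I _ hS => (I.T_injective hp).comp hS) (fun _ _ hS' hS => hS'.injective.comp hS) hα

theorem haarSeq_ne_zero (hp : p ≠ ∞) (hT : IsIndependentSystem T) (h : InTree α lam)
    (hα : α < ω₁) (I : Dyadic) : haarSeq T lam I ≠ 0 :=
  (map_ne_zero_iff _ (h.opSeq_injective hp hT hα)).2 I.haar_ne_zero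

theorem haarSeq_mem_meanZero (hT : IsIndependentSystem T) (h : InTree α lam) (hα : α < ω₁)
    (I : Dyadic) : haarSeq T lam I ∈ meanZero p :=
  h.opSeq_induction hT (Q := fun S => ∀ f ∈ meanZero p, S f ∈ meanZero p) (fun _ hf => hf)
    (fun J _ hS f hf => J.T_mem_meanZero (hS f hf))
    (fun _ _ hS' hS f hf => hS'.mem_meanZero (hS f hf)) hα _ I.haar_mem_meanZero

end InTree

/-! ### The martingale difference property -/

/-- The pair `a` may precede the pair `b` in an enumeration that is `Compatible`. -/
def MayPrecede (a b : List Entry × Dyadic) : Prop :=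
  (¬ a.1 <+: b.1 ∧ ¬ b.1 <+: a.1) ∨ (a.1 <+: b.1 ∧ a.1 ≠ b.1) ∨ (a.1 = b.1 ∧ a.2.LexLT b.2)

theorem mayPrecede_cons_iff {e : Entry} {l m : List Entry} {I J : Dyadic} :
    MayPrecede (e :: l, I) (e :: m, J) ↔ MayPrecede (l, I) (m, J) := by
  simp [MayPrecede, List.cons_prefix_cons]

theorem mayPrecede_singleton_iff {e : Entry} {l : List Entry} {I J : Dyadic} :
    MayPrecede (e :: l, I) ([e], J) ↔ l = [] ∧ I.LexLT J := by
  simp [MayPrecede, List.cons_prefix_cons, List.prefix_nil]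

section Precursor

variable {p : ℝ≥0∞} {T : Ordinal.{0} → Ordinal.{0} → LpI p →ₗ[ℝ] LpI p} {α β : Ordinal.{0}}
  {nu : List Entry} {I K : Dyadic} {f : LpI p}

/-- The functions `h_J^μ`, `μ ∈ 𝒯_α`, that may precede `h_I^λ`. The constants are included because
an `h_J^μ` living outside of an interval `K`, or constant on `K`, is seen by a function supported in
`K` only as a constant. -/
inductive IsPrecursor (T : Ordinal.{0} → Ordinal.{0} → LpI p →ₗ[ℝ] LpI p) (α : Ordinal.{0})
    (lam : List Entry) (I : Dyadic) : LpI p → Prop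
  | const (c : ℝ) : IsPrecursor T α lam I (Lp.const p unitMeasure c)
  | haarSeq (mu : List Entry) (J : Dyadic) (hmu : InTree α mu) (hJ : J.level < kappaSeq mu)
      (h : MayPrecede (mu, J) (lam, I)) : IsPrecursor T α lam I (haarSeq T mu J)

namespace IsPrecursor

theorem exists_eq_on_of_head (h : IsPrecursor T α [Entry.ord α] I f) :
    ∃ c, ∀ᵐ t ∂unitMeasure, t ∈ I.toSet → f t = c := by
  cases h with
  | const c => exact ⟨c, (Lp.coeFn_const p unitMeasure c).mono fun _ ht _ => ht⟩
  | haarSeq mu J hmu hJ h =>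
    obtain ⟨l, rfl⟩ := hmu.exists_eq_cons
    obtain ⟨rfl, hlt⟩ := mayPrecede_singleton_iff.1 h
    obtain ⟨c, hc⟩ := hlt.exists_haarFun_eq_on
    exact ⟨c, J.coeFn_haar.mono fun t ht htI => ht.trans (hc t htI)⟩

theorem exists_eq_rescale_of_eq_const {c : ℝ} (hf : ∀ᵐ t ∂unitMeasure, t ∈ K.toSet → f t = c) :
    ∃ f', IsPrecursor T β nu I f' ∧ ∀ᵐ t ∂unitMeasure, t ∈ K.toSet → f t = f' (K.rescale t) := by
  refine ⟨_, .const c, ?_⟩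
  filter_upwards [hf, K.ae_rescale (Lp.coeFn_const p unitMeasure c)] with t hft hct ht
  exact (hft ht).trans (hct ht).symm

theorem exists_eq_rescale_of_branch (hκ : kappa α ≠ 0) (hαβ : α = β + (kappa α : Ordinal.{0}))
    (hK : K.level = kappa α) (h : IsPrecursor T α (Entry.ord α :: Entry.int K :: nu) I f) :
    ∃ f', IsPrecursor T β nu I f' ∧ ∀ᵐ t ∂unitMeasure, t ∈ K.toSet → f t = f' (K.rescale t) := by
  cases h with
  | const c =>
    exact exists_eq_rescale_of_eq_const ((Lp.coeFn_const p unitMeasure c).mono fun _ ht _ => ht)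
  | haarSeq mu J hmu hJ h =>
    cases hmu with
    | head _ _ =>
      obtain ⟨c, hc⟩ := Dyadic.exists_haarFun_eq_on (I := J) (J := K) (hK ▸ hJ)
      exact exists_eq_rescale_of_eq_const (J.coeFn_haar.mono fun t ht htK => ht.trans (hc t htK))
    | branch _ β' K' mu _ hαβ' hK' hmu =>
      have hT := K'.coeFn_T (opSeq T mu (J.haar p))
      by_cases hKK : K' = K
      · subst hKK
        obtain rfl : β' = β := (Ordinal.add_right_cancel (kappa α)).1 (hαβ'.symm.trans hαβ)
        rw [kappaSeq_cons _ (List.cons_ne_nil _ _), kappaSeq_cons _ hmu.ne_nil] at hJ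
        rw [mayPrecede_cons_iff, mayPrecede_cons_iff] at h
        exact ⟨_, .haarSeq mu J hmu hJ h,
          hT.mono fun t ht htK => ht.trans (Set.indicator_of_mem htK _)⟩
      · have hdisj := Dyadic.disjoint_of_level_eq (hK'.trans hK.symm) hKK
        exact exists_eq_rescale_of_eq_const (hT.mono fun t ht htK =>
          ht.trans (Set.indicator_of_notMem (Set.disjoint_right.1 hdisj htK) _))
    | limit _ _ _ hlim => exact absurd (kappa_of_isSuccLimit hlim) hκ

theorem exists_eq_add_of_limit (hT : IsIndependentSystem T) (hα : α < ω₁)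
    (hlim : Order.IsSuccLimit α) (hβ1 : 1 ≤ β) (hβ : β < α)
    (h : IsPrecursor T α (Entry.ord α :: nu) I f) :
    ∃ u b v, IsPrecursor T β nu I u ∧ (b < α ∧ b ≠ β) ∧ f = T α β u + T α b v := by
  have h0 : 0 < α ∧ 0 ≠ β := ⟨hlim.bot_lt, (zero_lt_one.trans_le hβ1).ne⟩
  cases h with
  | const c =>
    exact ⟨_, 0, 0, .const c, h0, by
      rw [((hT α hα hlim).1 β hβ).map_const, map_zero, add_zero]⟩
  | haarSeq mu J hmu hJ h =>
    cases hmu with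
    | head _ hκ => exact absurd (kappa_of_isSuccLimit hlim) hκ
    | branch _ _ _ _ hκ => exact absurd (kappa_of_isSuccLimit hlim) hκ
    | limit _ β' mu _ _ hβ' hmu =>
      rw [BRS.haarSeq, hmu.opSeq_limit, LinearMap.comp_apply]
      by_cases hββ : β' = β
      · subst hββ
        rw [kappaSeq_cons _ hmu.ne_nil] at hJ
        rw [mayPrecede_cons_iff] at h
        exact ⟨_, 0, 0, .haarSeq mu J hmu hJ h, h0, by rw [map_zero, add_zero]; rfl⟩
      · exact ⟨_, β', _, .const 0, ⟨hβ', hββ⟩, by rw [map_zero, map_zero, zero_add]⟩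

end IsPrecursor

theorem InTree.meanZeroGiven_haarSeq [Fact (1 ≤ p)] (hT : IsIndependentSystem T)
    {lam : List Entry} (h : InTree α lam) (hα : α < ω₁) {ι : Type*} [Finite ι] {f : ι → LpI p}
    (hf : ∀ k, IsPrecursor T α lam I (f k)) :
    MeanZeroGiven unitMeasure (fun t k => f k t) (haarSeq T lam I) := by
  induction h generalizing f with
  | head α _ =>
    choose c hc using fun k => (hf k).exists_eq_on_of_head
    refine .of_eq_const_on_support (c := c) ?_ I.haar_mem_meanZero
    filter_upwards [ae_all_iff.2 hc, I.coeFn_haar (p := p)] with t hct ht hne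
    have htI : t ∈ I.toSet := by_contra fun htI => hne (ht.trans (I.haarFun_of_notMem htI))
    exact funext fun k => hct k htI
  | branch α β K nu hκ hαβ hK _ ih =>
    choose f' hf' hff' using fun k => (hf k).exists_eq_rescale_of_branch hκ hαβ hK
    exact (ih ((hαβ ▸ le_self_add : β ≤ α).trans_lt hα) hf').T hff'
  | limit α β nu hlim hβ1 hβ hnu ih =>
    choose u b v hu hb hfk using fun k => (hf k).exists_eq_add_of_limit hT hα hlim hβ1 hβ
    obtain rfl : f = fun k => T α β (u k) + T α (b k) (v k) := funext hfk
    rw [haarSeq, hnu.opSeq_limit]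
    exact hT.meanZeroGiven_add hα hlim hβ hb (ih (hβ.trans hα) hu)

theorem isMDS_haarSeq [Fact (1 ≤ p)] (hT : IsIndependentSystem T) (hα : α < ω₁) {N : ℕ∞}
    {lam : ℕ → List Entry} {I : ℕ → Dyadic}
    (hmem : ∀ n : ℕ, (n : ℕ∞) < N → (lam n, I n) ∈ haarIndex α) (hcomp : Compatible N lam I) :
    IsMDS N fun n => haarSeq T (lam n) (I n) := by
  intro n _ hn
  have hlt (k : Fin n) : ((k : ℕ) : ℕ∞) < N := (Nat.cast_lt.2 k.2).trans hn
  have hmean := (hmem n hn).1.meanZeroGiven_haarSeq hT hα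
    (f := fun k : Fin n => haarSeq T (lam k) (I k)) fun k =>
      .haarSeq _ _ (hmem k (hlt k)).1 (hmem k (hlt k)).2 (hcomp k n k.2 hn)
  have hcomap : MeasurableSpace.comap (fun t (k : Fin n) => haarSeq T (lam k) (I k) t)
      inferInstance = ⨆ k : Fin n, MeasurableSpace.comap (haarSeq T (lam k) (I k)) (borel ℝ) := by
    simp only [MeasurableSpace.pi, MeasurableSpace.comap_iSup, MeasurableSpace.comap_comp]
    rfl
  rw [← hcomap]
  exact hmean.condExp_eq_zero (measurable_pi_coe _) ((Lp.memLp _).integrable Fact.out)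

end Precursor

/-! ### The spaces `R_α^p` -/

section Center

variable {p : ℝ≥0∞}

/-- The constant function `1`. -/
abbrev one (p : ℝ≥0∞) : LpI p := Lp.const p unitMeasure (1 : ℝ)

theorem Dyadic.T_one (J : Dyadic) : J.T p (one p) = J.char p := by rw [T_const, one_smul]

theorem Dyadic.char_unit : unit.char p = one p := by rw [← T_one, T_unit]

variable [Fact (1 ≤ p)]

theorem abs_integral_le_norm (f : LpI p) : |∫ t, f t ∂unitMeasure| ≤ ‖f‖ :=
  calc |∫ t, f t ∂unitMeasure| ≤ ∫ t, ‖f t‖ ∂unitMeasure :=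
        norm_integral_le_integral_norm (f : ℝ → ℝ)
    _ = (eLpNorm f 1 unitMeasure).toReal := by
        rw [eLpNorm_one_eq_lintegral_enorm,
          integral_norm_eq_lintegral_enorm (Lp.aestronglyMeasurable f)]
    _ ≤ ‖f‖ := by
        rw [Lp.norm_def]
        exact ENNReal.toReal_mono (Lp.eLpNorm_ne_top f)
          (eLpNorm_le_eLpNorm_of_exponent_le Fact.out (Lp.aestronglyMeasurable f))

variable (p) in
/-- The expectation as a continuous linear functional on `L_p`. -/
def mean : LpI p →L[ℝ] ℝ :=
  LinearMap.mkContinuous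
    { toFun := fun f => ∫ t, f t ∂unitMeasure
      map_add' := fun f g => by
        rw [integral_congr_ae (Lp.coeFn_add f g)]
        exact integral_add ((Lp.memLp f).integrable Fact.out) ((Lp.memLp g).integrable Fact.out)
      map_smul' := fun c f => by
        rw [integral_congr_ae (Lp.coeFn_smul c f)]
        exact integral_smul c (f : ℝ → ℝ) } 1 fun f => by
    rw [one_mul]
    exact abs_integral_le_norm f

theorem mem_meanZero_iff {f : LpI p} : f ∈ meanZero p ↔ mean p f = 0 := Iff.rfl

theorem isClosed_meanZero : IsClosed (meanZero p : Set (LpI p)) :=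
  isClosed_eq (mean p).continuous continuous_const

theorem mean_one : mean p (one p) = 1 := by
  change ∫ t, one p t ∂unitMeasure = 1
  rw [integral_congr_ae (Lp.coeFn_const p unitMeasure (1 : ℝ))]
  simp

variable (p) in
/-- The projection `f ↦ f - 𝔼 f` of `L_p` onto the functions of mean zero. -/
def center : LpI p →L[ℝ] LpI p := ContinuousLinearMap.id ℝ _ - (mean p).smulRight (one p)

theorem center_apply (f : LpI p) : center p f = f - mean p f • one p := rfl

theorem center_mem_meanZero (f : LpI p) : center p f ∈ meanZero p := by
  rw [mem_meanZero_iff, center_apply, map_sub, map_smul, mean_one, smul_eq_mul, mul_one, sub_self]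

theorem center_of_mem {f : LpI p} (hf : f ∈ meanZero p) : center p f = f := by
  rw [center_apply, mem_meanZero_iff.1 hf, zero_smul, sub_zero]

theorem center_one : center p (one p) = 0 := by
  rw [center_apply, mean_one, one_smul, sub_self]

theorem Dyadic.center_T (J : Dyadic) (f : LpI p) :
    center p (J.T p f) = mean p f • center p (J.char p) + J.T p (center p f) := by
  rw [← center_of_mem (J.T_mem_meanZero (center_mem_meanZero f)), ← map_smul, ← map_add,
    ← J.T_one, center_apply f, map_sub, map_smul, add_sub_cancel]

theorem IsDistributionalEmbedding.center_map {S : LpI p →ₗ[ℝ] LpI p}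
    (hS : IsDistributionalEmbedding S) (f : LpI p) : center p (S f) = S (center p f) := by
  have hmean : mean p (S f) = mean p f := hS.integral_eq f
  rw [center_apply, center_apply, map_sub, map_smul, hS.map_const, hmean]

theorem Dyadic.center_char_mem_dyadicMeanZero (J : Dyadic) :
    center p (J.char p) ∈ dyadicMeanZero p J.level := by
  refine ⟨sub_mem (char_mem_charSpan le_rfl) (Submodule.smul_mem _ _ ?_), center_mem_meanZero _⟩
  rw [← char_unit]
  exact char_mem_charSpan (Nat.zero_le _)

end Center

section IsClosed

variable {p : ℝ≥0∞} {I J : Dyadic}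

theorem Dyadic.norm_T_le_norm_add (h : Disjoint I.toSet J.toSet) (f g : LpI p) :
    ‖I.T p f‖ ≤ ‖I.T p f + J.T p g‖ := by
  refine Lp.norm_le_norm_of_ae_le ?_
  filter_upwards [I.coeFn_T f, J.coeFn_T g, Lp.coeFn_add (I.T p f) (J.T p g)] with t hI hJ hadd
  rw [hadd, Pi.add_apply, hI, hJ]
  by_cases ht : t ∈ I.toSet
  · rw [Set.indicator_of_notMem (Set.disjoint_left.1 h ht), add_zero]
  · rw [Set.indicator_of_notMem ht, norm_zero]
    exact norm_nonneg _

variable [Fact (1 ≤ p)]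

theorem Dyadic.antilipschitz_coprod_T (hp : p ≠ ∞) (h : Disjoint I.toSet J.toSet)
    (hlevel : I.level = J.level) :
    ∃ K, AntilipschitzWith K ((I.T p).coprod (J.T p)) := by
  set c : ℝ := ((1 / 2) ^ I.level) ^ (1 / p.toReal) with hc
  have hc0 : 0 < c := by positivity
  refine ⟨c⁻¹.toNNReal, AddMonoidHomClass.antilipschitz_of_bound _ fun x => ?_⟩
  rw [Real.coe_toNNReal _ (by positivity), LinearMap.coprod_apply, ← div_eq_inv_mul,
    le_div_iff₀ hc0, Prod.norm_def, mul_comm, mul_max_of_nonneg _ _ hc0.le]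
  refine max_le ?_ ?_
  · rw [hc, ← norm_T hp]
    exact norm_T_le_norm_add h _ _
  · rw [hc, hlevel, ← norm_T hp, add_comm]
    exact norm_T_le_norm_add h.symm _ _

theorem Dyadic.isClosed_map_T_sup_map_T (hp : p ≠ ∞) (h : Disjoint I.toSet J.toSet)
    (hlevel : I.level = J.level) {A : Submodule ℝ (LpI p)} (hA : IsClosed (A : Set (LpI p))) :
    IsClosed ((A.map (I.T p) ⊔ A.map (J.T p) : Submodule ℝ (LpI p)) : Set (LpI p)) := by
  obtain ⟨K, hK⟩ := antilipschitz_coprod_T (p := p) hp h hlevel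
  have hcont : Continuous ((I.T p).coprod (J.T p)) :=
    ((I.continuous_T hp).comp continuous_fst).add ((J.continuous_T hp).comp continuous_snd)
  have hemb := hK.isClosedEmbedding
    (ContinuousLinearMap.uniformContinuous (⟨_, hcont⟩ : LpI p × LpI p →L[ℝ] LpI p))
  rw [← LinearMap.map_coprod_prod, Submodule.map_coe, Submodule.prod_coe]
  exact hemb.isClosedMap _ (hA.prod hA)

end IsClosed

section R

variable {p : ℝ≥0∞} [Fact (1 ≤ p)] {T : Ordinal.{0} → Ordinal.{0} → LpI p →ₗ[ℝ] LpI p}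
  {α β : Ordinal.{0}}

theorem R_zero : R T 0 = ℝ ∙ one p := Ordinal.limitRecOn_zero ..

theorem R_add_one (α : Ordinal.{0}) : R T (α + 1) =
    (R T α).map (Dyadic.unit.plus.T p) ⊔ (R T α).map (Dyadic.unit.minus.T p) := by
  have hT {I : Dyadic} {a b : ℝ} (hab : a < b) (ha : I.left = a) (hb : I.right = b) :
      I.T p = compress p a b hab := by
    subst ha hb
    rfl
  rw [hT (I := Dyadic.unit.plus) (a := 0) (b := 1 / 2) (by norm_num)
      (by simp [Dyadic.left, Dyadic.plus, Dyadic.unit])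
      (by simp [Dyadic.right, Dyadic.plus, Dyadic.unit]),
    hT (I := Dyadic.unit.minus) (a := 1 / 2) (b := 1) (by norm_num)
      (by simp [Dyadic.left, Dyadic.minus, Dyadic.unit])
      (by simp [Dyadic.right, Dyadic.minus, Dyadic.unit, one_add_one_eq_two])]
  exact Ordinal.limitRecOn_add_one ..

theorem R_limit (hlim : Order.IsSuccLimit α) :
    R T α = (⨆ β : Set.Iio α, (R T β.1).map (T α β)).topologicalClosure :=
  Ordinal.limitRecOn_limit _ _ _ _ hlim

theorem isClosed_R (hp : p ≠ ∞) (α : Ordinal.{0}) : IsClosed (R T α : Set (LpI p)) := by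
  induction α using Ordinal.limitRecOn with
  | zero => rw [R_zero]; exact Submodule.closed_of_finiteDimensional _
  | add_one α ih =>
    rw [R_add_one]
    exact Dyadic.isClosed_map_T_sup_map_T hp Dyadic.unit.disjoint_plus_minus rfl ih
  | limit α hα _ => rw [R_limit hα]; exact Submodule.isClosed_topologicalClosure _

theorem isClosed_R0 (hp : p ≠ ∞) (α : Ordinal.{0}) : IsClosed (R0 T α : Set (LpI p)) :=
  (isClosed_R hp α).inter isClosed_meanZero

theorem T_mem_R_of_isSuccLimit (hlim : Order.IsSuccLimit α) (hβ : β < α) {f : LpI p}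
    (hf : f ∈ R T β) : T α β f ∈ R T α := by
  rw [R_limit hlim]
  exact Submodule.le_topologicalClosure _
    (Submodule.mem_iSup_of_mem (⟨β, hβ⟩ : Set.Iio α) (Submodule.mem_map_of_mem hf))

theorem Dyadic.T_mem_R_add_level (J : Dyadic) {f : LpI p} (hf : f ∈ R T β) :
    J.T p f ∈ R T (β + J.level) := by
  induction h : J.level generalizing J with
  | zero => rwa [eq_unit h, T_unit, Nat.cast_zero, add_zero]
  | succ k ih =>
    rw [Nat.cast_succ, ← add_assoc, R_add_one]
    obtain ⟨K, hK, rfl | rfl⟩ := exists_eq_comp h <;> rw [← T_T]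
    · exact Submodule.mem_sup_left (Submodule.mem_map_of_mem (ih K hK))
    · exact Submodule.mem_sup_right (Submodule.mem_map_of_mem (ih K hK))

theorem R_add_nat_le (β : Ordinal.{0}) (k : ℕ) {W : Submodule ℝ (LpI p)}
    (hW : ∀ J : Dyadic, J.level = k → ∀ f ∈ R T β, J.T p f ∈ W) : R T (β + k) ≤ W := by
  induction k generalizing W with
  | zero =>
    rw [Nat.cast_zero, add_zero]
    exact fun f hf => Dyadic.T_unit f ▸ hW Dyadic.unit rfl f hf
  | succ k ih =>
    rw [Nat.cast_succ, ← add_assoc, R_add_one]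
    refine sup_le ?_ ?_ <;> refine Submodule.map_le_iff_le_comap.2 (ih fun J hJ f hf => ?_) <;>
      rw [Submodule.mem_comap, Dyadic.T_T]
    · exact hW _ (by rw [← hJ]; exact Nat.add_comm _ _) f hf
    · exact hW _ (by rw [← hJ]; exact Nat.add_comm _ _) f hf

theorem charSpan_le_R (hone : one p ∈ R T β) (k : ℕ) : Dyadic.charSpan p k ≤ R T (β + k) := by
  refine Submodule.span_le.2 ?_
  rintro _ ⟨J, rfl, rfl⟩
  rw [← J.T_one]
  exact J.T_mem_R_add_level hone

theorem one_mem_R (hT : IsIndependentSystem T) (hα : α < ω₁) : one p ∈ R T α := by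
  induction α using Ordinal.limitRecOn with
  | zero => rw [R_zero]; exact Submodule.mem_span_singleton_self _
  | add_one α ih =>
    rw [← Dyadic.char_unit, ← Nat.cast_one]
    exact charSpan_le_R (ih ((lt_add_one α).trans hα)) 1
      (Dyadic.char_mem_charSpan (I := Dyadic.unit) zero_le_one)
  | limit α hlim ih =>
    have h0 : (0 : Ordinal.{0}) < α := hlim.bot_lt
    rw [one, ← ((hT α hα hlim).1 0 h0).map_const]
    exact T_mem_R_of_isSuccLimit hlim h0 (ih 0 h0 (h0.trans hα))

theorem InTree.haarSeq_mem_R (hT : IsIndependentSystem T) {lam : List Entry} (h : InTree α lam)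
    (hα : α < ω₁) {I : Dyadic} (hI : I.level < kappaSeq lam) : haarSeq T lam I ∈ R T α := by
  induction h with
  | head α _ =>
    obtain ⟨β, _, hβ⟩ := exists_eq_add_kappa α
    rw [hβ] at hα ⊢
    exact charSpan_le_R (one_mem_R hT (le_self_add.trans_lt hα)) _ (Dyadic.haar_mem_charSpan hI)
  | branch α β K nu _ hαβ hK hnu ih =>
    rw [kappaSeq_cons _ (List.cons_ne_nil _ _), kappaSeq_cons _ hnu.ne_nil] at hI
    rw [hαβ] at hα ⊢
    exact hK ▸ K.T_mem_R_add_level (ih (le_self_add.trans_lt hα) hI)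
  | limit α β nu hlim _ hβ hnu ih =>
    rw [kappaSeq_cons _ hnu.ne_nil] at hI
    rw [haarSeq, hnu.opSeq_limit]
    exact T_mem_R_of_isSuccLimit hlim hβ (ih (hβ.trans hα) hI)

end R

/-! ### Density of the Haar system -/

section HaarSpan

variable {p : ℝ≥0∞} {T : Ordinal.{0} → Ordinal.{0} → LpI p →ₗ[ℝ] LpI p} {α β : Ordinal.{0}}

/-- The linear span of all functions `h_I^λ`, `λ ∈ 𝒯_α`. -/
def haarSpan (T : Ordinal.{0} → Ordinal.{0} → LpI p →ₗ[ℝ] LpI p) (α : Ordinal.{0}) :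
    Submodule ℝ (LpI p) :=
  Submodule.span ℝ ((fun x : List Entry × Dyadic => haarSeq T x.1 x.2) '' haarIndex α)

variable [Fact (1 ≤ p)]

theorem closure_haarSpan_le_R0 (hp : p ≠ ∞) (hT : IsIndependentSystem T) (hα : α < ω₁) :
    (haarSpan T α).topologicalClosure ≤ R0 T α := by
  refine Submodule.topologicalClosure_minimal _ (Submodule.span_le.2 ?_) (isClosed_R0 hp α)
  rintro _ ⟨x, ⟨hx, hI⟩, rfl⟩
  exact ⟨hx.haarSeq_mem_R hT hα hI, hx.haarSeq_mem_meanZero hT hα _⟩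

theorem dyadicMeanZero_le_haarSpan (hκ : kappa α ≠ 0) :
    dyadicMeanZero p (kappa α) ≤ haarSpan T α := by
  rw [dyadicMeanZero_eq_span]
  refine Submodule.span_le.2 ?_
  rintro _ ⟨I, hI, rfl⟩
  exact Submodule.subset_span ⟨([Entry.ord α], I), ⟨.head α hκ, hI⟩, rfl⟩

theorem map_mem_closure_haarSpan {S : LpI p →ₗ[ℝ] LpI p} (hS : Continuous S)
    (h : ∀ lam I, InTree β lam → I.level < kappaSeq lam → S (haarSeq T lam I) ∈ haarSpan T α)
    {f : LpI p} (hf : f ∈ (haarSpan T β).topologicalClosure) :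
    S f ∈ (haarSpan T α).topologicalClosure := by
  have hle : haarSpan T β ≤ (haarSpan T α).comap S := by
    refine Submodule.span_le.2 ?_
    rintro _ ⟨x, ⟨hx, hI⟩, rfl⟩
    exact h _ _ hx hI
  exact map_mem_closure hS hf hle

theorem Dyadic.T_mem_closure_haarSpan (hp : p ≠ ∞) (J : Dyadic) (hκ : kappa α ≠ 0)
    (hαβ : α = β + (kappa α : Ordinal.{0})) (hJ : J.level = kappa α) {f : LpI p}
    (hf : f ∈ (haarSpan T β).topologicalClosure) :
    J.T p f ∈ (haarSpan T α).topologicalClosure := by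
  refine map_mem_closure_haarSpan (J.continuous_T hp) (fun lam I hlam hI => ?_) hf
  refine Submodule.subset_span ⟨(Entry.ord α :: Entry.int J :: lam, I),
    ⟨.branch α β J lam hκ hαβ hJ hlam, ?_⟩, rfl⟩
  rwa [kappaSeq_cons _ (List.cons_ne_nil _ _), kappaSeq_cons _ hlam.ne_nil]

theorem not_inTree_zero {lam : List Entry} : ¬ InTree 0 lam := by
  intro h
  cases h with
  | head _ hκ => exact hκ kappa_zero
  | branch _ _ _ _ hκ => exact hκ kappa_zero
  | limit _ _ _ hlim => exact hlim.ne_bot rfl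

theorem IsIndependentSystem.map_mem_closure_haarSpan (hT : IsIndependentSystem T) (hα : α < ω₁)
    (hlim : Order.IsSuccLimit α) (hβ : β < α) {f : LpI p}
    (hf : f ∈ (haarSpan T β).topologicalClosure) :
    T α β f ∈ (haarSpan T α).topologicalClosure := by
  refine BRS.map_mem_closure_haarSpan ((hT α hα hlim).1 β hβ).continuous
    (fun lam I hlam hI => ?_) hf
  have hβ1 : 1 ≤ β := Order.one_le_iff_pos.2 (pos_iff_ne_zero.2 fun h =>
    not_inTree_zero (h ▸ hlam))
  refine Submodule.subset_span ⟨(Entry.ord α :: lam, I), ⟨.limit α β lam hlim hβ1 hβ hlam, ?_⟩, ?_⟩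
  · rwa [kappaSeq_cons _ hlam.ne_nil]
  · change opSeq T (Entry.ord α :: lam) _ = _
    rw [hlam.opSeq_limit]
    rfl

theorem center_mem_closure_haarSpan_of_isSuccLimit (hT : IsIndependentSystem T) (hα : α < ω₁)
    (hlim : Order.IsSuccLimit α)
    (ih : ∀ β < α, ∀ f ∈ R T β, center p f ∈ (haarSpan T β).topologicalClosure) {f : LpI p}
    (hf : f ∈ R T α) : center p f ∈ (haarSpan T α).topologicalClosure := by
  suffices h : R T α ≤ (haarSpan T α).topologicalClosure.comap (center p).toLinearMap from h hf
  rw [R_limit hlim]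
  refine Submodule.topologicalClosure_minimal _ (iSup_le fun ⟨β, hβ⟩ => ?_)
    ((Submodule.isClosed_topologicalClosure _).preimage (center p).continuous)
  rintro _ ⟨g, hg, rfl⟩
  change center p (T α β g) ∈ (haarSpan T α).topologicalClosure
  rw [((hT α hα hlim).1 β hβ).center_map]
  exact hT.map_mem_closure_haarSpan hα hlim hβ (ih β hβ g hg)

theorem center_mem_closure_haarSpan_of_kappa_ne_zero (hp : p ≠ ∞) (hκ : kappa α ≠ 0)
    (hαβ : α = β + (kappa α : Ordinal.{0}))
    (ih : ∀ f ∈ R T β, center p f ∈ (haarSpan T β).topologicalClosure) {f : LpI p}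
    (hf : f ∈ R T α) : center p f ∈ (haarSpan T α).topologicalClosure := by
  suffices h : R T (β + (kappa α : Ordinal.{0})) ≤
      (haarSpan T α).topologicalClosure.comap (center p).toLinearMap from h (hαβ ▸ hf)
  refine R_add_nat_le β _ fun J hJ g hg => ?_
  change center p (J.T p g) ∈ (haarSpan T α).topologicalClosure
  rw [J.center_T]
  exact add_mem (Submodule.smul_mem _ _ (Submodule.le_topologicalClosure _
      (dyadicMeanZero_le_haarSpan hκ (hJ ▸ J.center_char_mem_dyadicMeanZero))))
    (J.T_mem_closure_haarSpan hp hκ hαβ hJ (ih g hg))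

theorem center_mem_closure_haarSpan (hp : p ≠ ∞) (hT : IsIndependentSystem T) (hα : α < ω₁)
    {f : LpI p} (hf : f ∈ R T α) : center p f ∈ (haarSpan T α).topologicalClosure := by
  induction α using WellFoundedLT.induction generalizing f with
  | ind α ih =>
  obtain ⟨β, hβ, hαβ⟩ := exists_eq_add_kappa α
  by_cases hκ : kappa α = 0
  · obtain rfl : α = β := by simpa [hκ] using hαβ
    rcases hβ with rfl | hlim
    · rw [R_zero] at hf
      obtain ⟨c, rfl⟩ := Submodule.mem_span_singleton.1 hf
      rw [map_smul, center_one, smul_zero]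
      exact zero_mem _
    · exact center_mem_closure_haarSpan_of_isSuccLimit hT hα hlim
        (fun γ hγ g hg => ih γ hγ (hγ.trans hα) hg) hf
  · have hβα : β < α :=
      (lt_add_of_pos_right β (mod_cast Nat.pos_of_ne_zero hκ)).trans_eq hαβ.symm
    exact center_mem_closure_haarSpan_of_kappa_ne_zero hp hκ hαβ
      (fun g hg => ih β hβα (hβα.trans hα) hg) hf

theorem closure_haarSpan_eq_R0 (hp : p ≠ ∞) (hT : IsIndependentSystem T) (hα : α < ω₁) :
    (haarSpan T α).topologicalClosure = R0 T α :=
  le_antisymm (closure_haarSpan_le_R0 hp hT hα) fun _ hf =>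
    center_of_mem hf.2 ▸ center_mem_closure_haarSpan hp hT hα hf.1

end HaarSpan

/-! ### The Haar system as an unconditional basis -/

section Unconditional

variable {p : ℝ≥0∞}

theorem norm_rpow_eq_integral (hp0 : p ≠ 0) (hp : p ≠ ∞) (f : LpI p) :
    ‖f‖ ^ p.toReal = ∫ t, |f t| ^ p.toReal ∂unitMeasure := by
  have hnonneg : 0 ≤ ∫ t, |f t| ^ p.toReal ∂unitMeasure := integral_nonneg fun t => by positivity
  rw [Lp.norm_def, (Lp.memLp f).eLpNorm_eq_integral_rpow_norm hp0 hp]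
  simp only [Real.norm_eq_abs]
  rw [ENNReal.toReal_ofReal (by positivity), Real.rpow_inv_rpow hnonneg
    (ENNReal.toReal_pos hp0 hp).ne']

theorem norm_sum_smul_rpow_eq_integral (hp0 : p ≠ 0) (hp : p ≠ ∞) (s : Finset ℕ) (a : ℕ → ℝ)
    (f : ℕ → LpI p) : ‖∑ n ∈ s, a n • f n‖ ^ p.toReal =
      ∫ t, |∑ n ∈ s, a n * f n t| ^ p.toReal ∂unitMeasure := by
  rw [norm_rpow_eq_integral hp0 hp]
  refine integral_congr_ae ?_
  have hsmul : ∀ᵐ t ∂unitMeasure, ∀ n, (a n • f n : LpI p) t = a n * f n t :=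
    ae_all_iff.2 fun n => Lp.coeFn_smul (a n) (f n)
  filter_upwards [hsmul, Lp.coeFn_fun_finsetSum s fun n => a n • f n] with t ht hsum
  rw [hsum]
  simp only [ht]

variable {N : ℕ∞} {f : ℕ → LpI p}

theorem IsMDS.isLpMDS (hf : IsMDS N f) {k : ℕ} (hk : (k : ℕ∞) ≤ N) :
    IsLpMDS unitMeasure p (fun n => ⨆ i : Fin n, MeasurableSpace.comap (f i) (borel ℝ)) k
      fun n => f n where
  memLp n _ := Lp.memLp (f n)
  le n _ := iSup_le fun i => (measurable_coe (f i)).comap_le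
  stronglyMeasurable n _ i hi := by
    refine Measurable.stronglyMeasurable (measurable_iff_comap_le.2 ?_)
    exact le_iSup (fun i : Fin n => MeasurableSpace.comap (f i) (borel ℝ)) ⟨i, hi⟩
  condExp_eq_zero n hn hn1 := hf n hn1 ((Nat.cast_lt.2 hn).trans_le hk)

variable [Fact (1 ≤ p)]

theorem IsMDS.exists_norm_sum_range_le (hp1 : 1 < p) (hp : p ≠ ∞) (hf : IsMDS N f) :
    ∃ C : ℝ, ∀ k : ℕ, (k : ℕ∞) ≤ N → ∀ a b : ℕ → ℝ, (∀ n, |a n| ≤ |b n|) →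
      ‖∑ n ∈ Finset.range k, a n • f n‖ ≤ C * ‖∑ n ∈ Finset.range k, b n • f n‖ := by
  have hp0 : p ≠ 0 := (zero_lt_one.trans hp1).ne'
  have hpos : 0 < p.toReal := ENNReal.toReal_pos hp0 hp
  obtain ⟨C, hC0, hC⟩ := exists_integral_transform_le
    (ENNReal.toReal_one ▸ (ENNReal.toReal_lt_toReal ENNReal.one_ne_top hp).2 hp1)
  rw [ENNReal.ofReal_toReal hp] at hC
  refine ⟨C ^ p.toReal⁻¹, fun k hk a b hab => ?_⟩
  have hle : ∀ n, |a n / b n| ≤ 1 := fun n => by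
    rw [abs_div]
    exact div_le_one_of_le₀ (hab n) (abs_nonneg _)
  have hmul : ∀ n, a n / b n * b n = a n := fun n =>
    div_mul_cancel_of_imp fun hb => abs_nonpos_iff.1 (by simpa [hb] using hab n)
  have hint := hC unitMeasure ((hf.isLpMDS hk).const_mul b) hle
  simp only [← mul_assoc, hmul] at hint
  rw [← norm_sum_smul_rpow_eq_integral hp0 hp, ← norm_sum_smul_rpow_eq_integral hp0 hp] at hint
  refine (Real.rpow_le_rpow_iff (norm_nonneg _) (by positivity) hpos).1 ?_
  rwa [Real.mul_rpow (by positivity) (norm_nonneg _), Real.rpow_inv_rpow hC0.le hpos.ne']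

theorem IsMDS.exists_unconditionalOn (hp1 : 1 < p) (hp : p ≠ ∞) (hf : IsMDS N f) :
    ∃ C, UnconditionalOn {n : ℕ | (n : ℕ∞) < N} f C := by
  obtain ⟨C, hC⟩ := hf.exists_norm_sum_range_le hp1 hp
  refine ⟨C, fun s hs a b hab => ?_⟩
  have hsup : ((s.sup Nat.succ : ℕ) : ℕ∞) ≤ N :=
    Finset.sup_induction (p := fun k : ℕ => (k : ℕ∞) ≤ N) bot_le
      (fun k hk l hl => by rcases le_total k l with h | h <;> simpa [h])
      fun n hn => by simpa using Order.add_one_le_of_lt (hs hn)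
  have hsub : s ⊆ Finset.range (s.sup Nat.succ) := fun n hn =>
    Finset.mem_range.2 (Finset.le_sup (f := Nat.succ) hn)
  have hrange (c : ℕ → ℝ) : ∑ n ∈ Finset.range (s.sup Nat.succ), (if n ∈ s then c n else 0) • f n =
      ∑ n ∈ s, c n • f n := by
    simp only [ite_smul, zero_smul, Finset.sum_ite_mem, Finset.inter_eq_right.2 hsub]
  rw [← hrange a, ← hrange b]
  refine hC _ hsup _ _ fun n => ?_
  split_ifs with hn
  exacts [hab n hn, le_rfl]

end Unconditional

section HaarSystem

variable {p : ℝ≥0∞} [Fact (1 ≤ p)] {T : Ordinal.{0} → Ordinal.{0} → LpI p →ₗ[ℝ] LpI p}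
  {α : Ordinal.{0}} {N : ℕ∞} {lam : ℕ → List Entry} {I : ℕ → Dyadic}

theorem X_eq_span (lam : List Entry) :
    X T lam = Submodule.span ℝ (haarSeq T lam '' {I | I.level < kappaSeq lam}) := by
  rw [X, dyadicMeanZero_eq_span, Submodule.map_span, Set.image_image]
  rfl

theorem finiteDimensional_X (lam : List Entry) : FiniteDimensional ℝ (X T lam) := by
  rw [X_eq_span]
  exact FiniteDimensional.span_of_finite ℝ ((Dyadic.finite_setOf_level_lt _).image _)

theorem X_eq_span_haarIndex {lam : List Entry} (h : lam ∈ tree α) :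
    X T lam = Submodule.span ℝ
      ((fun x : List Entry × Dyadic => haarSeq T x.1 x.2) '' {x ∈ haarIndex α | x.1 = lam}) := by
  rw [X_eq_span]
  congr 1
  ext f
  constructor
  · rintro ⟨I, hI, rfl⟩
    exact ⟨(lam, I), ⟨⟨h, hI⟩, rfl⟩, rfl⟩
  · rintro ⟨⟨_, I⟩, ⟨⟨_, hI⟩, rfl⟩, rfl⟩
    exact ⟨I, hI, rfl⟩

theorem closedSpan_haarSeq (hp : p ≠ ∞) (hT : IsIndependentSystem T) (hα : α < ω₁)
    (henum : Enumerates N (fun n => (lam n, I n)) (haarIndex α)) :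
    closedSpan N (fun n => haarSeq T (lam n) (I n)) = R0 T α := by
  rw [← closure_haarSpan_eq_R0 hp hT hα, closedSpan, haarSpan, ← henum.image_eq, Set.image_image]

theorem exists_unconditionalOn_haarSeq (hp1 : 1 < p) (hp : p ≠ ∞) (hT : IsIndependentSystem T)
    (hα : α < ω₁) (henum : Enumerates N (fun n => (lam n, I n)) (haarIndex α))
    (hcomp : Compatible N lam I) :
    ∃ C, UnconditionalOn (haarIndex α)
      (fun x : List Entry × Dyadic => haarSeq T x.1 x.2) C := by
  obtain ⟨C, hC⟩ := (isMDS_haarSeq hT hα henum.mapsTo hcomp).exists_unconditionalOn hp1 hp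
  exact ⟨C, hC.of_surjOn (s := fun n => (lam n, I n)) henum.surjOn⟩

variable {C : ℝ}

theorem UnconditionalOn.isUnconditionalBasis_haarSeq (hp : p ≠ ∞) (hT : IsIndependentSystem T)
    (hα : α < ω₁)
    (h : UnconditionalOn (haarIndex α) (fun x : List Entry × Dyadic => haarSeq T x.1 x.2) C)
    (henum : Enumerates N (fun n => (lam n, I n)) (haarIndex α)) :
    IsUnconditionalBasis N (R0 T α) fun n => haarSeq T (lam n) (I n) := by
  rw [← closedSpan_haarSeq hp hT hα henum]
  have hne : ∀ x ∈ haarIndex α, haarSeq T x.1 x.2 ≠ 0 := fun x hx =>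
    InTree.haarSeq_ne_zero hp hT hx.1 hα x.2
  exact h.isUnconditionalBasis_of_enumerates (s := fun n => (lam n, I n)) henum hne

theorem UnconditionalOn.isUnconditionalFDD_X (hp : p ≠ ∞) (hT : IsIndependentSystem T)
    (hα : α < ω₁)
    (h : UnconditionalOn (haarIndex α) (fun x : List Entry × Dyadic => haarSeq T x.1 x.2) C)
    {ν : ℕ → List Entry} (hν : Enumerates N ν (tree α)) :
    IsUnconditionalFDD N (R0 T α) fun n => X T (ν n) := by
  rw [← closure_haarSpan_eq_R0 hp hT hα]
  have hfst : Set.MapsTo Prod.fst (haarIndex α) (tree α) := fun _ hx => hx.1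
  exact h.isUnconditionalFDD hν hfst (fun _ => X_eq_span_haarIndex)
    fun lam _ => finiteDimensional_X lam

end HaarSystem

end BRS

end

theorem mainTheorem4 (p : ℝ≥0∞) [Fact (1 ≤ p)] (hp1 : 1 < p) (hp : p ≠ ∞)
    (T : Ordinal.{0} → Ordinal.{0} → BRS.LpI p →ₗ[ℝ] BRS.LpI p) (hT : BRS.IsIndependentSystem T)
    (α : Ordinal.{0}) (hα : α < ω₁)
    (N : ℕ∞) (lam : ℕ → List BRS.Entry) (I : ℕ → BRS.Dyadic)
    (henum : BRS.Enumerates N (fun n => (lam n, I n)) (BRS.haarIndex α))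
    (hcomp : BRS.Compatible N lam I) :
    BRS.IsMDS N (fun n => BRS.haarSeq T (lam n) (I n)) ∧
    BRS.closedSpan N (fun n => BRS.haarSeq T (lam n) (I n)) = BRS.R0 T α ∧
    BRS.IsUnconditionalBasis N (BRS.R0 T α) (fun n => BRS.haarSeq T (lam n) (I n)) ∧
    ∀ (M : ℕ∞) (nu : ℕ → List BRS.Entry), BRS.Enumerates M nu (BRS.tree α) →
      BRS.IsUnconditionalFDD M (BRS.R0 T α) (fun n => BRS.X T (nu n)) := by
  obtain ⟨C, hC⟩ := BRS.exists_unconditionalOn_haarSeq hp1 hp hT hα henum hcomp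
  exact ⟨BRS.isMDS_haarSeq hT hα henum.mapsTo hcomp, BRS.closedSpan_haarSeq hp hT hα henum,
    hC.isUnconditionalBasis_haarSeq hp hT hα henum,
    fun _ _ hν => hC.isUnconditionalFDD_X hp hT hα hν⟩
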